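/- Let $\mathbb F_q$ be a finite field with $q$ elements, $F=\mathbb F_q(\!(t^{-1})\!)$, $\mathcal O=\mathbb F_q[\![t^{-1}]\!]$, $\pi=t^{-1}$, $G=PGL(3,F)$, $\Gamma=PGL(3,\mathbb F_q[t])\subset G$, and let $W\subset G$ be the image of $GL(3,\mathcal O)$. Let $\mathcal B(G)$ be the Bruhat–Tits building of $G$: its vertices are the homothety classes $[L]$ of $\mathcal O$-lattices $L\subset F^3$ (identified with $G/W$), and two vertices are adjacent if they have representatives with $\pi L\subsetneq L'\subsetneq L$. The color is $\tau([L])=\log_q[\mathcal O^3:\pi^iL]\in\mathbb Z/3\mathbb Z$ for large $i$. For integers $m\ge n\ge 0$ let $v_{m,n}=\Gamma\,\mathrm{diag}(t^m,t^n,1)\,W$; these are the vertices of the quotient complex $\Gamma\backslash\mathcal B(G)$. Write $\Gamma_x$ for the stabilizer in $\Gamma$ of a vertex $x$ of $\mathcal B(G)$. The vertex of the quotient represented by $x$ has weight $w=q^3(q+1)(q-1)^2/|\Gamma_x|$, and the edge of the quotient represented by an edge $\{x,y\}$ of $\mathcal B(G)$ has weight $w=q^3(q+1)(q-1)^2/|\Gamma_x\cap\Gamma_y|$.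 Let $L^2_w(\Gamma\backslash\mathcal B(G))$ be the space of complex functions $f$ on the vertices of $\Gamma\backslash\mathcal B(G)$ with $\sum_u|f(u)|^2w(u)<\infty$. For a complex function $f$ on the vertices of $\Gamma\backslash\mathcal B(G)$ put $$A_w^\pm f(u)=\sum_{\substack{(u,v)\ \text{edge}\\ \tau(v)=\tau(u)\pm1}}\frac{w(u,v)}{w(u)}\,f(v).$$ Let $S=\{(s_1,s_2,s_3)\in\mathbb C^3: s_1s_2s_3=1,\ \overline{s_1+s_2+s_3}=s_1^{-1}+s_2^{-1}+s_3^{-1}\}$. For $\mathbf s\in S$ denote by $f_{\mathbf s}$ a simultaneous eigenfunction, that is, a function $f_{\mathbf s}\ne0$ on the vertices of $\Gamma\backslash\mathcal B(G)$ with $A_w^{\pm}f_{\mathbf s}=q(s_1^{\pm1}+s_2^{\pm1}+s_3^{\pm1})f_{\mathbf s}$. **Proposition.** The trivial eigenfunctions are the only eigenfunctions $f_{\mathbf s}$, $\mathbf s\in S$, that belong to $L^2_w(\Gamma\backslash\mathcal B(G))$: an eigenfunction $f_{\mathbf s}$ lies in $L^2_w(\Gamma\backslash\mathcal B(G))$ if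 and only if there are $\omega\in\mathbb C$ with $\omega^3=1$ and a constant $c\neq0$ such that $f_{\mathbf s}(v_{m,n})=c\,\omega^{m+n}$ for all $m\ge n\ge0$. Conversely, for each $\omega$ with $\omega^3=1$ there is $\mathbf s\in S$ such that $v_{m,n}\mapsto\omega^{m+n}$ is such an eigenfunction $f_{\mathbf s}$, and this function lies in $L^2_w(\Gamma\backslash\mathcal B(G))$. Hence the pairs $(\lambda^+,\lambda^-)\in\mathbb C^2$ for which there is a nonzero $f\in L^2_w(\Gamma\backslash\mathcal B(G))$ with $A_w^+f=\lambda^+f$ and $A_w^-f=\lambda^-f$ are exactly the pairs $((q^2+q+1)\omega,(q^2+q+1)\omega^{-1})$ with $\omega^3=1$; and the discrete spectrum (the set of eigenvalues with a nonzero eigenfunction in $L^2_w(\Gamma\backslash\mathcal B(G))$) of $A_w^+$, and likewise of $A_w^-$, is exactly $$\Sigma_0=\{q^2+q+1,\ (q^2+q+1)e^{2\pi i/3},\ (q^2+q+1)e^{4\pi i/3}\}.$$ -/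

import Mathlib

open scoped MatrixGroups Pointwise Polynomial

noncomputable section

universe u

namespace AffineBuilding

/-- The local field `𝔽_q((t⁻¹))`: Laurent series over the finite field `K` in the
uniformizer `π = t⁻¹`. -/
abbrev LocalField (K : Type u) [Field K] : Type u := LaurentSeries K

/-- The valuation ring `𝒪 = 𝔽_q[[t⁻¹]]`. -/
abbrev Integers (K : Type u) [Field K] : Type u := PowerSeries K

section

variable (K : Type u) [Field K]

/-- The element `t = π⁻¹` of `𝔽_q((t⁻¹))`, as a unit. -/
def tUnit : (LocalField K)ˣ where
  val := HahnSeries.single (-1) 1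
  inv := HahnSeries.single 1 1
  val_inv := by simp
  inv_val := by simp

/-- The embedding `𝔽_q[t] → 𝔽_q((t⁻¹))` that sends the polynomial variable to `t`. -/
def polyEmb : K[X] →+* LocalField K :=
  Polynomial.eval₂RingHom (algebraMap K (LocalField K)) (tUnit K : LocalField K)

/-- The group `G = PGL(3, 𝔽_q((t⁻¹)))`. -/
abbrev G : Type u := PGL(3, LocalField K)

/-- The subgroup `W` of `G`: the image of `GL(3, 𝒪)`. -/
def W : Subgroup (G K) :=
  (Matrix.ProjGenLinGroup.mk.comp
    (Matrix.GeneralLinearGroup.map (n := Fin 3)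
      (algebraMap (Integers K) (LocalField K)))).range

/-- The subgroup `Γ = PGL(3, 𝔽_q[t])` of `G`: the image of `GL(3, 𝔽_q[t])`. -/
def Gam : Subgroup (G K) :=
  (Matrix.ProjGenLinGroup.mk.comp
    (Matrix.GeneralLinearGroup.map (n := Fin 3) (polyEmb K))).range

/-- The vertex set of the building, `G / W`. The coset of (the class of) `g` stands for the
homothety class of the lattice `g 𝒪³`. -/
abbrev Vertex : Type u := G K ⧸ W K

variable {K}

/-- The `𝒪`-lattice `g 𝒪³`, that is, the `𝒪`-span of the columns of `g`. -/
def lattice (g : GL (Fin 3) (LocalField K)) : Submodule (Integers K) (Fin 3 → LocalField K) :=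
  Submodule.span (Integers K) (Set.range fun j : Fin 3 => fun i : Fin 3 => g i j)

/-- The vertex `[g 𝒪³]`. -/
def toVertex (g : GL (Fin 3) (LocalField K)) : Vertex K :=
  QuotientGroup.mk (Matrix.ProjGenLinGroup.mk g)

/-- Two vertices are adjacent if they have representing lattices with `π L ⊊ L' ⊊ L`. -/
def Adj (x y : Vertex K) : Prop :=
  ∃ g h : GL (Fin 3) (LocalField K), toVertex g = x ∧ toVertex h = y ∧
    (PowerSeries.X : Integers K) • lattice g < lattice h ∧ lattice h < lattice g

/-- The valuation on `𝔽_q((t⁻¹))ˣ`, modulo 3. -/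
def valMod : (LocalField K)ˣ →* Multiplicative (ZMod 3) where
  toFun u := Multiplicative.ofAdd ((HahnSeries.order (u : LocalField K) : ℤ) : ZMod 3)
  map_one' := by simp
  map_mul' u v := by
    rw [Units.val_mul, HahnSeries.order_mul u.ne_zero v.ne_zero, Int.cast_add, ofAdd_add]

/-- The valuation of the determinant modulo 3, on `G`. -/
def valDet : G K →* Multiplicative (ZMod 3) :=
  Matrix.ProjGenLinGroup.lift (valMod.comp Matrix.GeneralLinearGroup.det) (by
    ext u
    have h : Matrix.GeneralLinearGroup.det (Matrix.GeneralLinearGroup.scalar (Fin 3) u)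
        = u ^ 3 := by
      ext
      simp
    simp only [MonoidHom.comp_apply, h, map_pow, MonoidHom.one_apply]
    rw [← ofAdd_toAdd (valMod u), ← ofAdd_nsmul]
    have h3 : (3 : ZMod 3) = 0 := by decide
    simp [h3])

theorem order_unit_integers (u : (Integers K)ˣ) :
    HahnSeries.order (algebraMap (Integers K) (LocalField K) u) = 0 := by
  have key : ∀ p : Integers K, p ≠ 0 →
      0 ≤ HahnSeries.order (algebraMap (Integers K) (LocalField K) p) := by
    intro p hp
    by_contra hneg
    push Not at hneg
    have hne : (algebraMap (Integers K) (LocalField K) p) ≠ 0 := by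
      rw [LaurentSeries.coe_algebraMap]
      intro h0
      exact hp (HahnSeries.ofPowerSeries_injective (Γ := ℤ) (h0.trans (map_zero _).symm))
    have hc := HahnSeries.coeff_order_eq_zero.not.mpr hne
    apply hc
    rw [LaurentSeries.coe_algebraMap] at hneg ⊢
    rw [PowerSeries.coeff_coe, if_pos hneg]
  have h1 := key u u.ne_zero
  have h2 := key (u⁻¹ : (Integers K)ˣ) (Units.ne_zero _)
  have hinj : Function.Injective (algebraMap (Integers K) (LocalField K)) := by
    rw [LaurentSeries.coe_algebraMap]
    exact HahnSeries.ofPowerSeries_injective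
  have h3 := HahnSeries.order_mul
    ((map_ne_zero_iff (algebraMap (Integers K) (LocalField K)) hinj).mpr u.ne_zero)
    ((map_ne_zero_iff (algebraMap (Integers K) (LocalField K)) hinj).mpr (u⁻¹).ne_zero)
  rw [← map_mul, Units.mul_inv, map_one, HahnSeries.order_one] at h3
  linarith

theorem W_le_ker_valDet : W K ≤ (valDet (K := K)).ker := by
  rintro _ ⟨g, rfl⟩
  rw [MonoidHom.mem_ker]
  change valMod (Matrix.GeneralLinearGroup.det
    (Matrix.GeneralLinearGroup.map (algebraMap (Integers K) (LocalField K)) g)) = 1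
  rw [Matrix.GeneralLinearGroup.map_det]
  have h := order_unit_integers (K := K) (Matrix.GeneralLinearGroup.det g)
  change Multiplicative.ofAdd ((HahnSeries.order (algebraMap (Integers K) (LocalField K)
    (Matrix.GeneralLinearGroup.det g)) : ℤ) : ZMod 3) = 1
  rw [h]
  simp

/-- The color `τ([L]) = log_q [𝒪³ : πⁱ L] mod 3` (for large `i`) of a vertex. For `L = g 𝒪³` the
logarithm of the index is the valuation of `det (πⁱ g)`, which is that of `det g` modulo 3. -/
def color (x : Vertex K) : ZMod 3 :=
  Quotient.liftOn' x (fun g => Multiplicative.toAdd (valDet g)) (by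
    intro a b hab
    have h := W_le_ker_valDet (QuotientGroup.leftRel_apply.mp hab)
    rw [MonoidHom.mem_ker, map_mul, map_inv, inv_mul_eq_one] at h
    exact congrArg Multiplicative.toAdd h)

variable (K) in
/-- The vertices of the quotient complex `Γ \ B(G)`. -/
abbrev QVertex : Type u := MulAction.orbitRel.Quotient (Gam K) (Vertex K)

variable (K) in
/-- The `Γ`-orbits of ordered pairs of vertices of the building. -/
abbrev QPair : Type u := MulAction.orbitRel.Quotient (Gam K) (Vertex K × Vertex K)

/-- The second end point of an orbit of pairs, a vertex of the quotient complex. -/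
def target (e : QPair K) : QVertex K :=
  Quotient.map' Prod.snd (by
    rintro a b ⟨γ, hγ⟩
    exact ⟨γ, congrArg Prod.snd hγ⟩) e

/-- The (oriented) edges of the quotient complex `Γ \ B(G)`, as `Γ`-orbits of adjacent pairs
`(x, y)`, that leave the vertex `u` and raise the color by `i`. -/
def edgesFrom (i : ZMod 3) (u : QVertex K) : Set (QPair K) :=
  {e | ∃ x y : Vertex K, Quotient.mk'' (x, y) = e ∧ Quotient.mk'' x = u ∧
    Adj x y ∧ color y = color x + i}

/-- The diagonal matrix `diag(a, b, c)`. -/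
def diagGL (a b c : (LocalField K)ˣ) : GL (Fin 3) (LocalField K) where
  val := Matrix.diagonal ![(a : LocalField K), b, c]
  inv := Matrix.diagonal ![((a⁻¹ : (LocalField K)ˣ) : LocalField K),
    (b⁻¹ : (LocalField K)ˣ), (c⁻¹ : (LocalField K)ˣ)]
  val_inv := by
    rw [Matrix.diagonal_mul_diagonal, ← Matrix.diagonal_one]
    congr 1
    ext j
    fin_cases j <;> simp
  inv_val := by
    rw [Matrix.diagonal_mul_diagonal, ← Matrix.diagonal_one]
    congr 1
    ext j
    fin_cases j <;> simp

variable (K) in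
/-- The vertex `v_{m,n}` of the quotient complex, the orbit `Γ diag(tᵐ, tⁿ, 1) W`. -/
def vtx (m n : ℕ) : QVertex K :=
  Quotient.mk'' (toVertex (diagGL (tUnit K ^ m) (tUnit K ^ n) 1))

end

section

variable {K : Type u} [Field K] [Fintype K]

/-- The weight `q³(q+1)(q-1)² / |Γ_x|` of the orbit of `x`, for a set `X` on which `Γ` acts.
With `X` the set of vertices this is the weight of the vertices `v` of the quotient complex;
with `X` the set of pairs of vertices it is the weight of its edges, as the stabilizer of the
pair `(x, y)` is `Γ_x ∩ Γ_y`. -/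
def weight {X : Type u} [MulAction (Gam K) X] (o : MulAction.orbitRel.Quotient (Gam K) X) : ℝ :=
  Quotient.liftOn' o
    (fun x => ((Fintype.card K : ℝ) ^ 3 * ((Fintype.card K : ℝ) + 1)
      * ((Fintype.card K : ℝ) - 1) ^ 2) / (Nat.card (MulAction.stabilizer (Gam K) x) : ℝ))
    (by
      rintro x y hxy
      have h := Nat.card_congr
        (MulAction.stabilizerEquivStabilizerOfOrbitRel hxy).toEquiv
      simp only [h])

/-- The weighted adjacency operator on functions on the vertices of the quotient complex:
`A f (u) = ∑ w(u,v)/w(u) f(v)` over the edges `(u,v)` with `τ(v) = τ(u) + i`.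
`A_w⁺` is the case `i = 1` and `A_w⁻` the case `i = -1`. -/
def adjOp (i : ZMod 3) (f : QVertex K → ℂ) (u : QVertex K) : ℂ :=
  ∑ᶠ e ∈ edgesFrom i u, ((weight e / weight u : ℝ) : ℂ) * f (target e)

/-- Membership in `L²_w(Γ \ B(G))`. -/
def MemL2 (f : QVertex K → ℂ) : Prop :=
  Summable fun u : QVertex K => ‖f u‖ ^ 2 * weight u

/-- `f` is a simultaneous eigenfunction of `A_w⁺` and `A_w⁻` with eigenvalues `lp`, `lm`. -/
def IsEigenfunction (lp lm : ℂ) (f : QVertex K → ℂ) : Prop :=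
  f ≠ 0 ∧ (∀ u, adjOp 1 f u = lp * f u) ∧ (∀ u, adjOp (-1) f u = lm * f u)

end

/-- The set `S` of spectral parameters `(s₁, s₂, s₃)`. -/
def paramSet : Set (Fin 3 → ℂ) :=
  {s | s 0 * s 1 * s 2 = 1 ∧
    (starRingEnd ℂ) (s 0 + s 1 + s 2) = (s 0)⁻¹ + (s 1)⁻¹ + (s 2)⁻¹}

end AffineBuilding

end

noncomputable section

universe u

namespace AffineBuilding

/-! ### Orders in the local field and the valuation of the determinant -/

section Basics

open Matrix hiding mul_inv_rev zpow_add zpow_neg_one inv_zpow'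

variable {K : Type u} [Field K]

/-! By orbit-stabilizer, `w(u,v)/w(u)` counts the neighbours of a representative of `u` that lie in
the given orbit of edges, so `A_w^±` is the plain sum over the neighbours in the building.
Neighbours of a lattice in one colour direction are the points or lines of the plane over `𝔽_q`,
normalized by upper unipotent matrices. Conjugating such a matrix by `diag(t^{d_i})` with `d`
decreasing gives a polynomial matrix, hence an element of `Γ`. So the quotient is the Weyl chamber
`m ≥ n ≥ 0`, and the three directions carry the coefficients `q²`, `q`, `1`, the sizes of the cells
of the plane (`exists_eq_vtx`, `vtx_injective`, `adjOp_one_vec`, `adjOp_neg_one_vec`).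

Let `f` be an eigenfunction with `λ⁻` conjugate to `λ⁺`. Eliminating the row `n = 1` between the two
equations on the wall `n = 0` shows that `b_n = f(v_{n,0})/q^n` satisfies a recurrence with
characteristic polynomial `X³ - s̄X² + sX - 1`, where `s = λ⁺/q`. The weight of `v_{n,0}`, `n ≥ 1`,
is a constant times `q^{-2n}`, so `f ∈ L²` forces `b_n → 0`. The roots have product 1 and are stable
under `z ↦ 1/z̄`, so at most one lies inside the unit disc (`norm_ge_one_of_root`), and a decaying
`b` is geometric, of ratio `r` say (`exists_ratio_of_tendsto_zero`). The equations at `v_{0,0}` and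
`v_{1,0}` then give `q r² = r̄`, whence `ω = q r` is a cube root of unity and `λ⁻ = (q²+q+1)ω`
(`eigenvalue_of_memL2`). An eigenfunction is determined by its value at `v_{0,0}`
(`eq_of_isEigenfunction`), so `f` is a multiple of `ω^{m+n}`. Conversely these functions are bounded
and the total weight is finite (`summable_weight`).

For `s ∈ S` the conjugacy of the eigenvalues is part of the hypothesis. In general it comes from
normality: `A_w⁺` and `A_w⁻` commute and are adjoint to each other on `L²_w`, so an `L²`
eigenfunction of one is an eigenfunction of the other for the conjugate eigenvalue
(`IsAdjointPair.apply_eq_of_apply_eq`). -/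

theorem algebraMap_integers_injective :
    Function.Injective (algebraMap (Integers K) (LocalField K)) := by
  rw [LaurentSeries.coe_algebraMap]
  exact HahnSeries.ofPowerSeries_injective

theorem coeff_algebraMap_of_neg (p : Integers K) {n : ℤ} (hn : n < 0) :
    (algebraMap (Integers K) (LocalField K) p).coeff n = 0 := by
  rw [LaurentSeries.coe_algebraMap, PowerSeries.coeff_coe, if_pos hn]

theorem coeff_algebraMap_natCast (p : Integers K) (n : ℕ) :
    (algebraMap (Integers K) (LocalField K) p).coeff n = PowerSeries.coeff n p := by
  rw [LaurentSeries.coe_algebraMap]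
  exact LaurentSeries.coeff_coe_powerSeries p n

theorem order_algebraMap_nonneg (p : Integers K) :
    0 ≤ (algebraMap (Integers K) (LocalField K) p).order := by
  by_cases hp : algebraMap (Integers K) (LocalField K) p = 0
  · simp [hp]
  by_contra h
  exact HahnSeries.coeff_order_eq_zero.not.mpr hp (coeff_algebraMap_of_neg p (not_le.mp h))

theorem isUnit_of_order_eq_zero {p : Integers K} (hp : p ≠ 0)
    (h : (algebraMap (Integers K) (LocalField K) p).order = 0) : IsUnit p := by
  have hne : algebraMap (Integers K) (LocalField K) p ≠ 0 :=
    (map_ne_zero_iff _ algebraMap_integers_injective).mpr hp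
  have h1 := HahnSeries.coeff_order_eq_zero.not.mpr hne
  rw [h] at h1
  have h2 := coeff_algebraMap_natCast p 0
  rw [PowerSeries.isUnit_iff_constantCoeff, isUnit_iff_ne_zero,
    ← PowerSeries.coeff_zero_eq_constantCoeff_apply, ← h2]
  exact_mod_cast h1

theorem isUnit_iff_order_eq_zero {p : Integers K} (hp : p ≠ 0) :
    IsUnit p ↔ (algebraMap (Integers K) (LocalField K) p).order = 0 :=
  ⟨fun ⟨u, hu⟩ => hu ▸ order_unit_integers u, isUnit_of_order_eq_zero hp⟩

theorem exists_algebraMap_of_order_nonneg {x : LocalField K} (h : 0 ≤ x.order) :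
    ∃ p : Integers K, algebraMap (Integers K) (LocalField K) p = x := by
  obtain ⟨n, hn⟩ := Int.eq_ofNat_of_zero_le h
  refine ⟨PowerSeries.X ^ n * x.powerSeriesPart, ?_⟩
  rw [LaurentSeries.coe_algebraMap]
  exact LaurentSeries.X_order_mul_powerSeriesPart hn.symm

theorem algebraMap_X :
    algebraMap (Integers K) (LocalField K) PowerSeries.X = ((tUnit K)⁻¹ : (LocalField K)ˣ) := by
  rw [LaurentSeries.coe_algebraMap, HahnSeries.ofPowerSeries_X]
  rfl

theorem val_tUnit_zpow (a : ℤ) :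
    ((tUnit K ^ a : (LocalField K)ˣ) : LocalField K) = HahnSeries.single (-a) 1 := by
  have h : ((tUnit K)⁻¹ : (LocalField K)ˣ) = (HahnSeries.single 1 1 : LocalField K) := rfl
  rw [RatFunc.single_zpow, ← h, ← Units.val_zpow_eq_zpow_val, inv_zpow', neg_neg]

theorem order_tUnit_zpow (a : ℤ) :
    ((tUnit K ^ a : (LocalField K)ˣ) : LocalField K).order = -a := by
  rw [val_tUnit_zpow, HahnSeries.order_single one_ne_zero]

theorem algebraMap_C (a : K) : algebraMap (Integers K) (LocalField K) (PowerSeries.C a) =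
    algebraMap K (LocalField K) a := by
  rw [LaurentSeries.coe_algebraMap, HahnSeries.ofPowerSeries_C, LaurentSeries.algebraMap_apply]

theorem polyEmb_C (a : K) : polyEmb K (Polynomial.C a) = algebraMap K (LocalField K) a := by
  simp [polyEmb]

theorem polyEmb_X : polyEmb K Polynomial.X = tUnit K := by
  simp [polyEmb]

/-- As `t` has order `-1`, degrees change sign; a lower bound on the order thus becomes a bound on
the degree. -/
theorem coeff_polyEmb (p : K[X]) (n : ℕ) : (polyEmb K p).coeff (-(n : ℤ)) = p.coeff n := by
  induction p using Polynomial.induction_on' with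
  | add p q hp hq => simp [hp, hq]
  | monomial m a =>
    rw [← Polynomial.C_mul_X_pow_eq_monomial, map_mul, map_pow, polyEmb_C, polyEmb_X,
      ← Units.val_pow_eq_pow_val, ← zpow_natCast, val_tUnit_zpow, LaurentSeries.algebraMap_apply,
      HahnSeries.C_mul_eq_smul, HahnSeries.coeff_smul, HahnSeries.coeff_single,
      Polynomial.coeff_C_mul, Polynomial.coeff_X_pow]
    simp

theorem polyEmb_injective : Function.Injective (polyEmb K) := by
  intro p r h
  ext n
  rw [← coeff_polyEmb, ← coeff_polyEmb, h]

theorem coeff_eq_zero_of_lt_order_polyEmb {p : K[X]} {n : ℕ} (h : -(n : ℤ) < (polyEmb K p).order) :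
    p.coeff n = 0 := by
  rw [← coeff_polyEmb]
  exact HahnSeries.coeff_eq_zero_of_lt_order h

theorem order_polyEmb_unit {p : K[X]} (hp : IsUnit p) : (polyEmb K p).order = 0 := by
  obtain ⟨c, hc, rfl⟩ := Polynomial.isUnit_iff.mp hp
  rw [polyEmb_C, LaurentSeries.algebraMap_apply, HahnSeries.order_C]

/-- The inclusion `GL(3, 𝒪) → GL(3, F)`. -/
abbrev intGL : GL (Fin 3) (Integers K) →* GL (Fin 3) (LocalField K) :=
  GeneralLinearGroup.map (algebraMap (Integers K) (LocalField K))

/-- The embedding `GL(3, 𝔽_q[t]) → GL(3, F)`. -/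
abbrev polyGL : GL (Fin 3) K[X] →* GL (Fin 3) (LocalField K) :=
  GeneralLinearGroup.map (polyEmb K)

/-- The inclusion `M₃(𝒪) → M₃(F)`. -/
abbrev intMat : Matrix (Fin 3) (Fin 3) (Integers K) →+* Matrix (Fin 3) (Fin 3) (LocalField K) :=
  (algebraMap (Integers K) (LocalField K)).mapMatrix

theorem intMat_injective : Function.Injective (intMat (K := K)) :=
  Matrix.map_injective algebraMap_integers_injective

theorem val_intGL (w : GL (Fin 3) (Integers K)) : (intGL w).val = intMat w.val := rfl

theorem toVertex_eq_iff {g h : GL (Fin 3) (LocalField K)} :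
    toVertex g = toVertex h ↔ ∃ (s : (LocalField K)ˣ) (w : GL (Fin 3) (Integers K)),
      g * intGL w * GeneralLinearGroup.scalar (Fin 3) s = h := by
  unfold toVertex
  rw [QuotientGroup.eq, W, MonoidHom.mem_range]
  constructor
  · rintro ⟨w, hw⟩
    rw [← map_inv, ← map_mul, MonoidHom.comp_apply, ProjGenLinGroup.mk_eq_mk_iff] at hw
    obtain ⟨s, hs⟩ := hw
    exact ⟨s, w, by rw [mul_assoc, hs]; group⟩
  · rintro ⟨s, w, rfl⟩
    refine ⟨w, ?_⟩
    rw [← map_inv, ← map_mul, MonoidHom.comp_apply, ProjGenLinGroup.mk_eq_mk_iff]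
    exact ⟨s, by group⟩

theorem toVertex_surjective : Function.Surjective (toVertex (K := K)) := by
  intro x
  obtain ⟨y, rfl⟩ := QuotientGroup.mk_surjective x
  obtain ⟨g, rfl⟩ := ProjGenLinGroup.mk_surjective y
  exact ⟨g, rfl⟩

theorem toVertex_mul_intGL (g : GL (Fin 3) (LocalField K)) (w : GL (Fin 3) (Integers K)) :
    toVertex (g * intGL w) = toVertex g :=
  (toVertex_eq_iff.mpr ⟨1, w, by simp⟩).symm

theorem toVertex_mul_scalar (g : GL (Fin 3) (LocalField K)) (s : (LocalField K)ˣ) :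
    toVertex (g * GeneralLinearGroup.scalar (Fin 3) s) = toVertex g :=
  (toVertex_eq_iff.mpr ⟨s, 1, by simp⟩).symm

/-- The valuation of the determinant. -/
def ordDet (g : GL (Fin 3) (LocalField K)) : ℤ := HahnSeries.order g.val.det

theorem ordDet_mul (g h : GL (Fin 3) (LocalField K)) : ordDet (g * h) = ordDet g + ordDet h := by
  rw [ordDet, Units.val_mul, det_mul,
    HahnSeries.order_mul (GeneralLinearGroup.det_ne_zero g) (GeneralLinearGroup.det_ne_zero h)]
  rfl

theorem ordDet_one : ordDet (1 : GL (Fin 3) (LocalField K)) = 0 := by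
  simp [ordDet]

theorem ordDet_inv (g : GL (Fin 3) (LocalField K)) : ordDet g⁻¹ = -ordDet g := by
  have h := ordDet_mul g g⁻¹
  rw [mul_inv_cancel, ordDet_one] at h
  linarith

theorem ordDet_intGL (w : GL (Fin 3) (Integers K)) : ordDet (intGL w) = 0 := by
  rw [ordDet, val_intGL, ← RingHom.map_det]
  exact order_unit_integers (GeneralLinearGroup.det w)

theorem ordDet_polyGL (w : GL (Fin 3) K[X]) : ordDet (polyGL w) = 0 := by
  have : (polyGL w).val = (polyEmb K).mapMatrix w.val := rfl
  rw [ordDet, this, ← RingHom.map_det]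
  exact order_polyEmb_unit (GeneralLinearGroup.det w).isUnit

theorem ordDet_scalar (s : (LocalField K)ˣ) :
    ordDet (GeneralLinearGroup.scalar (Fin 3) s) = 3 * HahnSeries.order (s : LocalField K) := by
  have : (GeneralLinearGroup.scalar (Fin 3) s).val.det = (s : LocalField K) ^ 3 := by simp
  rw [ordDet, this, HahnSeries.order_pow]
  simp

theorem color_toVertex (g : GL (Fin 3) (LocalField K)) :
    color (toVertex g) = ((ordDet g : ℤ) : ZMod 3) := rfl

theorem exists_intMat_eq {g : GL (Fin 3) (LocalField K)} {k : Matrix (Fin 3) (Fin 3) (Integers K)}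
    (hk : g.val = intMat k) (h0 : ordDet g = 0) : ∃ w, intGL w = g := by
  have hd : (algebraMap (Integers K) (LocalField K)) k.det = g.val.det := by
    rw [hk, RingHom.map_det]
  have hne : k.det ≠ 0 := by
    intro h
    rw [h, map_zero] at hd
    exact GeneralLinearGroup.det_ne_zero g hd.symm
  have hu : IsUnit k.det := isUnit_of_order_eq_zero hne (by rw [hd]; exact h0)
  refine ⟨GeneralLinearGroup.mk'' k hu, ?_⟩
  ext i j : 2
  rw [hk]
  rfl

theorem ordDet_nonneg_of_integral {g : GL (Fin 3) (LocalField K)}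
    {k : Matrix (Fin 3) (Fin 3) (Integers K)} (hk : g.val = intMat k) : 0 ≤ ordDet g := by
  rw [ordDet, hk, ← RingHom.map_det]
  exact order_algebraMap_nonneg _

end Basics

/-! ### Inclusions of lattices and adjacency as divisibility of matrices -/

section Lattices

open Matrix hiding mul_inv_rev zpow_add zpow_neg_one inv_zpow'

variable {K : Type u} [Field K]

theorem lattice_le_iff {g h : GL (Fin 3) (LocalField K)} :
    lattice h ≤ lattice g ↔ ∃ k, h.val = g.val * intMat k := by
  unfold lattice
  rw [Submodule.span_le, Set.range_subset_iff]
  simp only [SetLike.mem_coe, Submodule.mem_span_range_iff_exists_fun]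
  constructor
  · intro H
    choose c hc using H
    refine ⟨Matrix.of fun i j => c j i, ?_⟩
    ext i j : 2
    have := congrFun (hc j) i
    rw [← this, Matrix.mul_apply]
    simp [Algebra.smul_def, mul_comm]
  · rintro ⟨k, hk⟩ j
    refine ⟨fun i => k i j, ?_⟩
    ext i : 1
    have := congrFun (congrFun hk i) j
    rw [this, Matrix.mul_apply]
    simp [Algebra.smul_def, mul_comm]

theorem X_smul_lattice (g : GL (Fin 3) (LocalField K)) :
    (PowerSeries.X : Integers K) • lattice g =
      lattice (g * GeneralLinearGroup.scalar (Fin 3) (tUnit K)⁻¹) := by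
  unfold lattice
  rw [← Submodule.span_smul, ← Set.range_smul]
  congr 2
  ext j i : 2
  have h : (PowerSeries.X : Integers K) • g.val i j =
      g.val i j * ((tUnit K)⁻¹ : (LocalField K)ˣ) := by
    rw [Algebra.smul_def, algebraMap_X, mul_comm]
  have h2 : (g * GeneralLinearGroup.scalar (Fin 3) (tUnit K)⁻¹).val i j =
      g.val i j * ((tUnit K)⁻¹ : (LocalField K)ˣ) := by
    rw [Units.val_mul, GeneralLinearGroup.coe_scalar, Matrix.scalar_apply, Matrix.mul_diagonal]
  exact h.trans h2.symm

/-- Multiplication by the uniformizer. -/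
abbrev piGL : GL (Fin 3) (LocalField K) := GeneralLinearGroup.scalar (Fin 3) (tUnit K)⁻¹

theorem piGL_mul (g : GL (Fin 3) (LocalField K)) : piGL * g = g * piGL :=
  GeneralLinearGroup.scalar_commute _ _

theorem ordDet_piGL : ordDet (piGL : GL (Fin 3) (LocalField K)) = 3 := by
  rw [ordDet_scalar, ← zpow_neg_one, order_tUnit_zpow]
  norm_num

theorem toVertex_mul_piGL (g : GL (Fin 3) (LocalField K)) : toVertex (g * piGL) = toVertex g :=
  toVertex_mul_scalar _ _

/-- The difference of the determinant orders is the logarithm of the index, so it detects strictness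
of an inclusion. -/
theorem lattice_lt_iff {g h : GL (Fin 3) (LocalField K)} :
    lattice h < lattice g ↔ (∃ k, h.val = g.val * intMat k) ∧ 0 < ordDet h - ordDet g := by
  rw [lt_iff_le_not_ge, lattice_le_iff]
  refine and_congr_right ?_
  rintro ⟨k, hk⟩
  have hk' : (g⁻¹ * h).val = intMat k := by
    rw [Units.val_mul, hk, ← Matrix.mul_assoc, ← Units.val_mul, inv_mul_cancel, Units.val_one,
      Matrix.one_mul]
  have hord : ordDet (g⁻¹ * h) = ordDet h - ordDet g := by
    rw [ordDet_mul, ordDet_inv]; ring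
  have h0 := ordDet_nonneg_of_integral hk'
  rw [lattice_le_iff, ← hord]
  constructor
  · intro H
    refine lt_of_le_of_ne h0 fun h1 => H ?_
    obtain ⟨w, hw⟩ := exists_intMat_eq hk' h1.symm
    refine ⟨(w⁻¹).val, ?_⟩
    rw [← val_intGL, map_inv, hw, ← Units.val_mul]
    congr 1
    group
  · rintro H ⟨l, hl⟩
    have hl' : (h⁻¹ * g).val = intMat l := by
      rw [Units.val_mul, hl, ← Matrix.mul_assoc, ← Units.val_mul, inv_mul_cancel, Units.val_one,
        Matrix.one_mul]
    have h2 := ordDet_nonneg_of_integral hl'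
    rw [ordDet_mul, ordDet_inv] at h2
    linarith

/-- `g` has entries in `𝒪`. -/
def IsIntegral (g : GL (Fin 3) (LocalField K)) : Prop := ∃ k, g.val = intMat k

theorem IsIntegral.mul {g h : GL (Fin 3) (LocalField K)} (hg : IsIntegral g) (hh : IsIntegral h) :
    IsIntegral (g * h) := by
  obtain ⟨k, hk⟩ := hg
  obtain ⟨l, hl⟩ := hh
  exact ⟨k * l, by rw [Units.val_mul, hk, hl, map_mul]⟩

theorem isIntegral_intGL (w : GL (Fin 3) (Integers K)) : IsIntegral (intGL w) := ⟨w.val, rfl⟩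

theorem IsIntegral.ordDet_nonneg {g : GL (Fin 3) (LocalField K)} (hg : IsIntegral g) :
    0 ≤ ordDet g := by
  obtain ⟨k, hk⟩ := hg
  exact ordDet_nonneg_of_integral hk

theorem IsIntegral.exists_eq {g : GL (Fin 3) (LocalField K)} (hg : IsIntegral g)
    (h : ordDet g = 0) : ∃ w, intGL w = g := by
  obtain ⟨k, hk⟩ := hg
  exact exists_intMat_eq hk h

theorem lattice_lt_iff' {g h : GL (Fin 3) (LocalField K)} :
    lattice h < lattice g ↔ IsIntegral (g⁻¹ * h) ∧ 0 < ordDet (g⁻¹ * h) := by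
  rw [lattice_lt_iff, ordDet_mul, ordDet_inv, sub_eq_add_neg, add_comm]
  refine and_congr_left fun _ => exists_congr fun k => ?_
  rw [Units.val_mul, Units.inv_mul_eq_iff_eq_mul]

/-- The chain `πL ⊊ L' ⊊ L` is a factorization of `π` into two integral non-units. In this form
adjacency is visibly symmetric and invariant under `G`. -/
theorem adj_iff {x y : Vertex K} : Adj x y ↔ ∃ g k l : GL (Fin 3) (LocalField K),
    toVertex g = x ∧ toVertex (g * k) = y ∧ IsIntegral k ∧ IsIntegral l ∧ k * l = piGL ∧
      0 < ordDet k ∧ 0 < ordDet l := by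
  constructor
  · rintro ⟨g, h, rfl, rfl, h1, h2⟩
    rw [X_smul_lattice, lattice_lt_iff'] at h1
    rw [lattice_lt_iff'] at h2
    refine ⟨g, g⁻¹ * h, h⁻¹ * (g * piGL), rfl, by simp, h2.1, h1.1, by group, h2.2, h1.2⟩
  · rintro ⟨g, k, l, rfl, rfl, hk, hl, hkl, hk0, hl0⟩
    refine ⟨g, g * k, rfl, rfl, ?_, ?_⟩
    · rw [X_smul_lattice, lattice_lt_iff']
      have : (g * k)⁻¹ * (g * piGL) = l := by rw [← hkl]; group
      rw [this]
      exact ⟨hl, hl0⟩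
    · rw [lattice_lt_iff', inv_mul_cancel_left]
      exact ⟨hk, hk0⟩

theorem Adj.symm {x y : Vertex K} (h : Adj x y) : Adj y x := by
  obtain ⟨g, k, l, rfl, rfl, hk, hl, hkl, hk0, hl0⟩ := adj_iff.mp h
  refine adj_iff.mpr ⟨g * k, l, k, rfl, ?_, hl, hk, ?_, hl0, hk0⟩
  · rw [mul_assoc, hkl, toVertex_mul_piGL]
  · have : l = k⁻¹ * piGL := by rw [← hkl]; group
    rw [this, mul_assoc, piGL_mul, inv_mul_cancel_left]

theorem mk_smul_toVertex (γ g : GL (Fin 3) (LocalField K)) :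
    (ProjGenLinGroup.mk γ : G K) • toVertex g = toVertex (γ * g) := rfl

theorem Adj.smul {x y : Vertex K} (hxy : Adj x y) (γ : G K) : Adj (γ • x) (γ • y) := by
  obtain ⟨γ, rfl⟩ := ProjGenLinGroup.mk_surjective γ
  obtain ⟨g, k, l, rfl, rfl, h⟩ := adj_iff.mp hxy
  exact adj_iff.mpr ⟨γ * g, k, l, rfl, by rw [mk_smul_toVertex, mul_assoc], h⟩

end Lattices

/-! ### Unipotent normal forms for points and lines of the plane over `𝔽_q` -/

section Unipotent

open Matrix hiding mul_inv_rev zpow_add zpow_neg_one inv_zpow'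

/-- The upper unipotent matrix with entries `a`, `b` in the first row and `c` in the second. -/
def upperGL {R : Type*} [CommRing R] (a b c : R) : GL (Fin 3) R where
  val := !![1, a, b; 0, 1, c; 0, 0, 1]
  inv := !![1, -a, a * c - b; 0, 1, -c; 0, 0, 1]
  val_inv := by
    ext i j
    fin_cases i <;> fin_cases j <;> simp [Matrix.mul_apply, Fin.sum_univ_three]
    ring
  inv_val := by
    ext i j
    fin_cases i <;> fin_cases j <;> simp [Matrix.mul_apply, Fin.sum_univ_three]
    ring

theorem map_upperGL {R S : Type*} [CommRing R] [CommRing S] (f : R →+* S) (a b c : R) :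
    GeneralLinearGroup.map f (upperGL a b c) = upperGL (f a) (f b) (f c) := by
  ext i j
  fin_cases i <;> fin_cases j <;> simp [upperGL]

theorem val_upperGL {R : Type*} [CommRing R] (a b c : R) :
    (upperGL a b c).val = !![1, a, b; 0, 1, c; 0, 0, 1] := rfl

theorem inv_upperGL {R : Type*} [CommRing R] (a b c : R) :
    (upperGL a b c)⁻¹ = upperGL (-a) (a * c - b) (-c) := Units.ext rfl

variable (K : Type u) [Field K]

/-- The points of the projective plane over `K`, by normalized coordinates. -/
abbrev PlanePoint : Type u := (K × K) ⊕ K ⊕ Unit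

variable {K}

/-- The row that carries the functional of a normalized line. -/
def rowIndex : PlanePoint K → Fin 3 := Sum.elim (fun _ => 0) (Sum.elim (fun _ => 1) fun _ => 2)

/-- The unipotent matrix whose inverse carries the functional in the row `rowIndex`. -/
def rowUnip : PlanePoint K → GL (Fin 3) K :=
  Sum.elim (fun p => upperGL p.1 p.2 0) (Sum.elim (fun c => upperGL 0 0 c) fun _ => upperGL 0 0 0)

/-- The column that carries the vector of a normalized point. -/
def colIndex : PlanePoint K → Fin 3 := Sum.elim (fun _ => 2) (Sum.elim (fun _ => 1) fun _ => 0)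

/-- The unipotent matrix that carries the vector of a point in the column `colIndex`. -/
def colUnip : PlanePoint K → GL (Fin 3) K :=
  Sum.elim (fun p => upperGL 0 p.1 p.2) (Sum.elim (fun a => upperGL a 0 0) fun _ => upperGL 0 0 0)

/-- Scale the first nonzero coordinate to 1. The minus signs in the witnesses appear because the
functional is a row of the inverse matrix. -/
theorem exists_row_eq {v : Fin 3 → K} (hv : v ≠ 0) :
    ∃ i : PlanePoint K, ∃ c : K, c ≠ 0 ∧ v = c • ((rowUnip i)⁻¹).val (rowIndex i) := by
  by_cases h0 : v 0 = 0
  · by_cases h1 : v 1 = 0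
    · have h2 : v 2 ≠ 0 := fun h2 => hv (by ext i; fin_cases i <;> simp [h0, h1, h2])
      refine ⟨Sum.inr (Sum.inr ()), v 2, h2, ?_⟩
      ext i
      fin_cases i <;> simp [rowUnip, rowIndex, inv_upperGL, val_upperGL, h0, h1]
    · refine ⟨Sum.inr (Sum.inl (-(v 2 / v 1))), v 1, h1, ?_⟩
      ext i
      fin_cases i <;> simp [rowUnip, rowIndex, inv_upperGL, val_upperGL, h0, mul_div_cancel₀ _ h1]
  · refine ⟨Sum.inl (-(v 1 / v 0), -(v 2 / v 0)), v 0, h0, ?_⟩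
    ext i
    fin_cases i <;> simp [rowUnip, rowIndex, inv_upperGL, val_upperGL, mul_div_cancel₀ _ h0]

theorem exists_col_eq {v : Fin 3 → K} (hv : v ≠ 0) :
    ∃ i : PlanePoint K, ∃ c : K, c ≠ 0 ∧ v = c • fun r => (colUnip i).val r (colIndex i) := by
  by_cases h0 : v 2 = 0
  · by_cases h1 : v 1 = 0
    · have h2 : v 0 ≠ 0 := fun h2 => hv (by ext i; fin_cases i <;> simp [h0, h1, h2])
      refine ⟨Sum.inr (Sum.inr ()), v 0, h2, ?_⟩
      ext i
      fin_cases i <;> simp [colUnip, colIndex, val_upperGL, h0, h1]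
    · refine ⟨Sum.inr (Sum.inl (v 0 / v 1)), v 1, h1, ?_⟩
      ext i
      fin_cases i <;> simp [colUnip, colIndex, val_upperGL, h0, mul_div_cancel₀ _ h1]
  · refine ⟨Sum.inl (v 0 / v 2, v 1 / v 2), v 2, h0, ?_⟩
    ext i
    fin_cases i <;> simp [colUnip, colIndex, val_upperGL, mul_div_cancel₀ _ h0]

end Unipotent

/-! ### Diagonal matrices of powers of `t` -/

section Diagonal

open Matrix hiding mul_inv_rev zpow_add zpow_neg_one inv_zpow'

variable (K : Type u) [Field K]

/-- The diagonal matrix with the powers `t ^ d i`. -/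
def diagT (d : Fin 3 → ℤ) : GL (Fin 3) (LocalField K) :=
  diagGL (tUnit K ^ d 0) (tUnit K ^ d 1) (tUnit K ^ d 2)

theorem val_diagT (d : Fin 3 → ℤ) :
    (diagT K d).val = diagonal fun i => ((tUnit K ^ d i : (LocalField K)ˣ) : LocalField K) := by
  ext i j
  fin_cases i <;> fin_cases j <;> simp [diagT, diagGL]

theorem diagT_add (d e : Fin 3 → ℤ) : diagT K (d + e) = diagT K d * diagT K e := by
  apply Units.ext
  rw [Units.val_mul, val_diagT, val_diagT, val_diagT, diagonal_mul_diagonal]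
  congr 1
  ext1 i
  rw [Pi.add_apply, zpow_add, Units.val_mul]

theorem diagT_zero : diagT K 0 = 1 := by
  apply Units.ext
  rw [val_diagT]
  simp

theorem diagT_neg (d : Fin 3 → ℤ) : diagT K (-d) = (diagT K d)⁻¹ := by
  rw [eq_inv_iff_mul_eq_one, ← diagT_add, neg_add_cancel, diagT_zero]

theorem diagT_const (a : ℤ) :
    diagT K (fun _ => a) = GeneralLinearGroup.scalar (Fin 3) (tUnit K ^ a) := by
  apply Units.ext
  rw [val_diagT, GeneralLinearGroup.coe_scalar, scalar_apply]

theorem ordDet_diagT (d : Fin 3 → ℤ) : ordDet (diagT K d) = -(d 0 + d 1 + d 2) := by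
  rw [ordDet, val_diagT, det_diagonal, Fin.prod_univ_three, ← Units.val_mul, ← Units.val_mul,
    ← zpow_add, ← zpow_add, order_tUnit_zpow]

variable {K}

theorem isIntegral_mul_diagT {g : GL (Fin 3) (LocalField K)}
    {k : Matrix (Fin 3) (Fin 3) (Integers K)} (hk : g.val = intMat k) {j : Fin 3}
    (hj : ∀ r, PowerSeries.constantCoeff (k r j) = 0) :
    IsIntegral (g * diagT K (Pi.single j 1)) := by
  choose c hc using fun r => PowerSeries.X_dvd_iff.mpr (hj r)
  refine ⟨k.updateCol j c, ?_⟩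
  ext r s : 2
  rw [Units.val_mul, val_diagT, mul_diagonal, hk]
  by_cases hs : s = j
  · subst hs
    simp only [RingHom.mapMatrix_apply, map_apply, updateCol_self, Pi.single_eq_same]
    rw [hc, map_mul, algebraMap_X, zpow_one, mul_right_comm, Units.inv_mul, one_mul]
  · simp [hs]

theorem isIntegral_diagT_mul {g : GL (Fin 3) (LocalField K)}
    {k : Matrix (Fin 3) (Fin 3) (Integers K)} (hk : g.val = intMat k) {j : Fin 3}
    (hj : ∀ r, PowerSeries.constantCoeff (k j r) = 0) :
    IsIntegral (diagT K (Pi.single j 1) * g) := by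
  choose c hc using fun r => PowerSeries.X_dvd_iff.mpr (hj r)
  refine ⟨k.updateRow j c, ?_⟩
  ext r s : 2
  rw [Units.val_mul, val_diagT, diagonal_mul, hk]
  by_cases hs : r = j
  · subst hs
    simp only [RingHom.mapMatrix_apply, map_apply, updateRow_self, Pi.single_eq_same]
    rw [hc, map_mul, algebraMap_X, zpow_one, ← mul_assoc, Units.mul_inv, one_mul]
  · simp [hs]

theorem isIntegral_diagT {d : Fin 3 → ℤ} (hd : ∀ i, d i ≤ 0) : IsIntegral (diagT K d) := by
  have h : ∀ i, ∃ p : Integers K, algebraMap (Integers K) (LocalField K) p =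
      ((tUnit K ^ d i : (LocalField K)ˣ) : LocalField K) := fun i =>
    exists_algebraMap_of_order_nonneg (by rw [order_tUnit_zpow]; linarith [hd i])
  choose p hp using h
  refine ⟨diagonal p, ?_⟩
  rw [val_diagT, RingHom.mapMatrix_apply, diagonal_map (map_zero _)]
  simp_rw [hp]

/-- The inclusion `GL(3, 𝔽_q) → GL(3, F)`. -/
abbrev constGL : GL (Fin 3) K →* GL (Fin 3) (LocalField K) :=
  GeneralLinearGroup.map (algebraMap K (LocalField K))

/-- The inclusion `GL(3, 𝔽_q) → GL(3, 𝒪)`. -/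
abbrev serGL : GL (Fin 3) K →* GL (Fin 3) (Integers K) :=
  GeneralLinearGroup.map (PowerSeries.C (R := K))

theorem constGL_eq_intGL (u : GL (Fin 3) K) : constGL u = intGL (serGL u) := by
  refine GeneralLinearGroup.ext fun i j => ?_
  rw [GeneralLinearGroup.map_apply, GeneralLinearGroup.map_apply, GeneralLinearGroup.map_apply,
    algebraMap_C]

theorem isIntegral_constGL (u : GL (Fin 3) K) : IsIntegral (constGL u) := by
  rw [constGL_eq_intGL]
  exact isIntegral_intGL _

theorem ordDet_constGL (u : GL (Fin 3) K) : ordDet (constGL u) = 0 := by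
  rw [constGL_eq_intGL, ordDet_intGL]

end Diagonal

/-! ### Neighbours of a vertex, listed without repetition -/

section Neighbours

open Matrix hiding mul_inv_rev zpow_add zpow_neg_one inv_zpow'

variable {K : Type u} [Field K]

/-- The matrices `h` such that `g h 𝒪³` runs over the sublattices of index `q` of `g 𝒪³`. -/
def subGL (i : PlanePoint K) : GL (Fin 3) (LocalField K) :=
  constGL (rowUnip i) * diagT K (-Pi.single (rowIndex i) 1)

/-- The matrices `h` such that `g h 𝒪³` runs over the lattices that contain `g 𝒪³` with
index `q`. -/
def superGL (i : PlanePoint K) : GL (Fin 3) (LocalField K) :=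
  constGL (colUnip i) * diagT K (Pi.single (colIndex i) 1)

theorem ordDet_diagT_single (j : Fin 3) : ordDet (diagT K (Pi.single j 1)) = -1 := by
  rw [ordDet_diagT]
  fin_cases j <;> simp

theorem ordDet_subGL (i : PlanePoint K) : ordDet (subGL i) = 1 := by
  rw [subGL, ordDet_mul, ordDet_constGL, diagT_neg, ordDet_inv, ordDet_diagT_single]
  norm_num

theorem ordDet_superGL (i : PlanePoint K) : ordDet (superGL i) = -1 := by
  rw [superGL, ordDet_mul, ordDet_constGL, ordDet_diagT_single]
  norm_num

theorem isIntegral_subGL (i : PlanePoint K) : IsIntegral (subGL i) := by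
  refine (isIntegral_constGL _).mul (isIntegral_diagT fun s => ?_)
  rw [Pi.neg_apply, neg_nonpos]
  exact (Pi.single_nonneg (i := _) (α := fun _ => ℤ)).mpr zero_le_one s

theorem isIntegral_superGL_inv (i : PlanePoint K) : IsIntegral (superGL i)⁻¹ := by
  rw [superGL, mul_inv_rev, ← diagT_neg, ← map_inv]
  refine (isIntegral_diagT fun s => ?_).mul (isIntegral_constGL _)
  rw [Pi.neg_apply, neg_nonpos]
  exact (Pi.single_nonneg (i := _) (α := fun _ => ℤ)).mpr zero_le_one s

/-- Reduction of an integral matrix modulo the uniformizer. -/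
abbrev redMat : Matrix (Fin 3) (Fin 3) (Integers K) →+* Matrix (Fin 3) (Fin 3) K :=
  (PowerSeries.constantCoeff (R := K)).mapMatrix

theorem det_redMat_eq_zero {g : GL (Fin 3) (LocalField K)}
    {k : Matrix (Fin 3) (Fin 3) (Integers K)} (hk : g.val = intMat k) (h : 0 < ordDet g) :
    (redMat k).det = 0 := by
  rw [← RingHom.map_det]
  by_contra hne
  have hu : IsUnit k.det := by
    rwa [PowerSeries.isUnit_iff_constantCoeff, isUnit_iff_ne_zero]
  have h0 := (isUnit_iff_order_eq_zero hu.ne_zero).mp hu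
  rw [RingHom.map_det, ← hk] at h0
  exact h.ne' h0

/-- Modulo `π` the matrix is singular, so some functional over `𝔽_q` kills its image. Normalizing
that functional shows that the image lattice lies in the corresponding sublattice of index `q`. -/
theorem exists_isIntegral_subGL_inv_mul {g : GL (Fin 3) (LocalField K)} (hg : IsIntegral g)
    (h : 0 < ordDet g) : ∃ i, IsIntegral ((subGL i)⁻¹ * g) := by
  obtain ⟨k, hk⟩ := hg
  obtain ⟨v, hv, hvk⟩ := Matrix.exists_vecMul_eq_zero_iff.mpr (det_redMat_eq_zero hk h)
  obtain ⟨i, c, hc, rfl⟩ := exists_row_eq hv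
  rw [smul_vecMul, smul_eq_zero_iff_right hc] at hvk
  refine ⟨i, ?_⟩
  rw [subGL, mul_inv_rev, diagT_neg, inv_inv, mul_assoc, ← map_inv]
  set u := (rowUnip i)⁻¹
  refine isIntegral_diagT_mul (k := (serGL u).val * k) ?_ fun r => ?_
  · rw [Units.val_mul, hk, map_mul, constGL_eq_intGL, val_intGL]
  · have := congrFun hvk r
    rw [Matrix.mul_apply, map_sum]
    simpa [Matrix.vecMul, dotProduct] using this

/-- The dual argument: a kernel vector modulo `π` gives a column combination divisible by `π`, which
absorbs a factor `t`. -/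
theorem exists_isIntegral_mul_superGL {g : GL (Fin 3) (LocalField K)} (hg : IsIntegral g)
    (h : 0 < ordDet g) : ∃ i, IsIntegral (g * superGL i) := by
  obtain ⟨k, hk⟩ := hg
  obtain ⟨v, hv, hvk⟩ := Matrix.exists_mulVec_eq_zero_iff.mpr (det_redMat_eq_zero hk h)
  obtain ⟨i, c, hc, rfl⟩ := exists_col_eq hv
  rw [mulVec_smul, smul_eq_zero_iff_right hc] at hvk
  refine ⟨i, ?_⟩
  rw [superGL, ← mul_assoc]
  set u := colUnip i
  refine isIntegral_mul_diagT (k := k * (serGL u).val) ?_ fun r => ?_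
  · rw [Units.val_mul, hk, map_mul, constGL_eq_intGL, val_intGL]
  · have := congrFun hvk r
    rw [Matrix.mul_apply, map_sum]
    simpa [Matrix.mulVec, dotProduct] using this

theorem eq_one_of_intCast {n : ℤ} (h0 : 0 < n) (h3 : n < 3) (h : (n : ZMod 3) = 1) : n = 1 := by
  obtain rfl | rfl : n = 1 ∨ n = 2 := by omega
  · rfl
  · revert h; decide

theorem eq_two_of_intCast {n : ℤ} (h0 : 0 < n) (h3 : n < 3) (h : (n : ZMod 3) = -1) : n = 2 := by
  obtain rfl | rfl : n = 1 ∨ n = 2 := by omega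
  · revert h; decide
  · rfl

/-- In a factorization `kl = π` the orders of the determinants are positive with sum 3, so the
colour fixes the order of `det k` as 1. Splitting off one `subGL i` leaves an integral matrix with
unit determinant. -/
theorem adj_color_add_one_iff (g : GL (Fin 3) (LocalField K)) (y : Vertex K) :
    (Adj (toVertex g) y ∧ color y = color (toVertex g) + 1) ↔
      ∃ i, y = toVertex (g * subGL i) := by
  constructor
  · rintro ⟨hadj, hcol⟩
    obtain ⟨g', k, l, hg, rfl, hk, hl, hkl, hk0, hl0⟩ := adj_iff.mp hadj
    obtain ⟨s, w, rfl⟩ := toVertex_eq_iff.mp hg.symm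
    have hsum := congrArg ordDet hkl
    rw [ordDet_mul, ordDet_piGL] at hsum
    rw [← hg, color_toVertex, color_toVertex, ordDet_mul, Int.cast_add] at hcol
    have h1 := eq_one_of_intCast hk0 (by linarith) (add_left_cancel hcol)
    obtain ⟨i, hi⟩ := exists_isIntegral_subGL_inv_mul ((isIntegral_intGL w).mul hk)
      (by rw [ordDet_mul, ordDet_intGL, h1]; norm_num)
    obtain ⟨w', hw'⟩ := hi.exists_eq (by
      rw [ordDet_mul, ordDet_inv, ordDet_subGL, ordDet_mul, ordDet_intGL, h1]; norm_num)
    refine ⟨i, ?_⟩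
    have e : g * intGL w * GeneralLinearGroup.scalar (Fin 3) s * k =
        g * subGL i * intGL w' * GeneralLinearGroup.scalar (Fin 3) s := by
      rw [hw', mul_assoc _ (GeneralLinearGroup.scalar (Fin 3) s),
        GeneralLinearGroup.scalar_commute]
      group
    rw [e, toVertex_mul_scalar, toVertex_mul_intGL]
  · rintro ⟨i, rfl⟩
    refine ⟨adj_iff.mpr ⟨g, subGL i, (subGL i)⁻¹ * piGL, rfl, rfl, isIntegral_subGL i, ?_,
      by group, ?_, ?_⟩, ?_⟩
    · rw [subGL, mul_inv_rev, mul_assoc, ← piGL_mul, ← mul_assoc, diagT_neg, inv_inv, ← map_inv,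
        piGL, ← zpow_neg_one, ← diagT_const, ← diagT_add]
      refine (isIntegral_diagT fun s => ?_).mul (isIntegral_constGL _)
      by_cases hs : s = rowIndex i <;> simp [hs]
    · rw [ordDet_subGL]; norm_num
    · rw [ordDet_mul, ordDet_inv, ordDet_subGL, ordDet_piGL]; norm_num
    · rw [color_toVertex, color_toVertex, ordDet_mul, ordDet_subGL]; simp

theorem adj_color_sub_one_iff (g : GL (Fin 3) (LocalField K)) (y : Vertex K) :
    (Adj (toVertex g) y ∧ color y = color (toVertex g) + -1) ↔
      ∃ i, y = toVertex (g * superGL i) := by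
  constructor
  · rintro ⟨hadj, hcol⟩
    obtain ⟨g', k, l, hg, rfl, hk, hl, hkl, hk0, hl0⟩ := adj_iff.mp hadj
    obtain ⟨s, w, rfl⟩ := toVertex_eq_iff.mp hg.symm
    have hsum := congrArg ordDet hkl
    rw [ordDet_mul, ordDet_piGL] at hsum
    rw [← hg, color_toVertex, color_toVertex, ordDet_mul, Int.cast_add] at hcol
    have h1 := eq_two_of_intCast hk0 (by linarith) (add_left_cancel hcol)
    -- Here `k` has determinant order 2, so the complementary factor `l`, of order 1, is the one to
    -- be split.
    have hl1 : ordDet l = 1 := by linarith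
    obtain ⟨i, hi⟩ := exists_isIntegral_mul_superGL (hl.mul (isIntegral_intGL w⁻¹))
      (by rw [ordDet_mul, ordDet_intGL, hl1]; norm_num)
    obtain ⟨w', hw'⟩ := hi.exists_eq (by
      rw [ordDet_mul, ordDet_superGL, ordDet_mul, ordDet_intGL, hl1]; norm_num)
    refine ⟨i, ?_⟩
    have hk' : k = piGL * l⁻¹ := by rw [← hkl]; group
    have e : g * intGL w * GeneralLinearGroup.scalar (Fin 3) s * k =
        g * superGL i * intGL w'⁻¹ * (piGL * GeneralLinearGroup.scalar (Fin 3) s) := by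
      rw [map_inv, hw', mul_assoc _ (GeneralLinearGroup.scalar (Fin 3) s),
        GeneralLinearGroup.scalar_commute, hk', piGL_mul, map_inv]
      group
    rw [e, ← map_mul, toVertex_mul_scalar, toVertex_mul_intGL]
  · rintro ⟨i, rfl⟩
    refine ⟨adj_iff.mpr ⟨g, superGL i * piGL, (superGL i)⁻¹, rfl, ?_, ?_,
      isIntegral_superGL_inv i, ?_, ?_, ?_⟩, ?_⟩
    · rw [← mul_assoc, toVertex_mul_piGL]
    · rw [superGL, mul_assoc, piGL, ← zpow_neg_one, ← diagT_const, ← diagT_add]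
      refine (isIntegral_constGL _).mul (isIntegral_diagT fun s => ?_)
      by_cases hs : s = colIndex i <;> simp [hs]
    · rw [← piGL_mul, mul_inv_cancel_right]
    · rw [ordDet_mul, ordDet_superGL, ordDet_piGL]; norm_num
    · rw [ordDet_inv, ordDet_superGL]; norm_num
    · rw [color_toVertex, color_toVertex, ordDet_mul, ordDet_superGL]; simp

/-- The homothety factor changes the determinant order by three times its own order; equality forces
it to be a unit of `𝒪`, which can be absorbed into `w`. -/
theorem exists_integral_of_toVertex_eq {g h : GL (Fin 3) (LocalField K)}
    (he : toVertex g = toVertex h) (ho : ordDet g = ordDet h) : ∃ w, g * intGL w = h := by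
  obtain ⟨s, w, rfl⟩ := toVertex_eq_iff.mp he
  rw [ordDet_mul, ordDet_mul, ordDet_intGL, ordDet_scalar] at ho
  have hs : HahnSeries.order (s : LocalField K) = 0 := by linarith
  obtain ⟨p, hp⟩ := exists_algebraMap_of_order_nonneg hs.ge
  have hp0 : p ≠ 0 := by
    rintro rfl
    exact s.ne_zero (by rw [← hp, map_zero])
  obtain ⟨v, rfl⟩ := isUnit_of_order_eq_zero hp0 (by rw [hp, hs])
  refine ⟨w * GeneralLinearGroup.scalar (Fin 3) v, ?_⟩
  rw [map_mul, GeneralLinearGroup.map_scalar, mul_assoc]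
  congr 3
  exact Units.ext hp

theorem redMat_serGL (u : GL (Fin 3) K) : redMat (serGL u).val = u.val := by
  ext i j
  simp

theorem redMat_eq_of_eq_mul_diagT {A B : Matrix (Fin 3) (Fin 3) (Integers K)}
    {g : GL (Fin 3) (LocalField K)} (j : Fin 3) (h : g.val * (diagT K (-Pi.single j 1)).val = intMat A) (hB : g.val = intMat B) :
    redMat A = redMat B * diagonal (fun s => if s = j then 0 else 1) := by
  ext r s
  have h1 := congrFun (congrFun h r) s
  rw [val_diagT, mul_diagonal, hB] at h1
  rw [mul_diagonal]
  by_cases hs : s = j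
  · subst hs
    have h2 : A r s = B r s * PowerSeries.X := by
      apply algebraMap_integers_injective
      rw [map_mul, algebraMap_X]
      simpa using h1.symm
    simp [h2]
  · have h2 : A r s = B r s := by
      apply algebraMap_integers_injective
      simpa [hs] using h1.symm
    simp [h2, hs]

/-- Equal sublattices have equal images modulo `π`, that is, equal kernels of the two functionals;
these are then proportional, and normalized coordinates are unique. -/
theorem toVertex_mul_subGL_injective (g : GL (Fin 3) (LocalField K)) :
    Function.Injective fun i => toVertex (g * subGL i) := by
  intro i j hij
  obtain ⟨w, hw⟩ := exists_integral_of_toVertex_eq hij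
    (by rw [ordDet_mul, ordDet_mul, ordDet_subGL, ordDet_subGL])
  rw [mul_assoc, mul_right_inj] at hw
  have key : ∀ i : PlanePoint K, ∃ k, (subGL i).val = intMat k ∧ redMat k =
      (rowUnip i).val * diagonal (fun s => if s = rowIndex i then 0 else 1) := by
    intro i
    obtain ⟨k, hk⟩ := isIntegral_subGL i
    refine ⟨k, hk, ?_⟩
    rw [← redMat_serGL (rowUnip i)]
    refine redMat_eq_of_eq_mul_diagT (g := constGL (rowUnip i)) (rowIndex i) ?_ ?_
    · rw [← hk]; rfl
    · rw [constGL_eq_intGL]; rfl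
  obtain ⟨k, hk, hk'⟩ := key i
  obtain ⟨l, hl, hl'⟩ := key j
  have h1 : k * w.val = l := by
    apply intMat_injective
    rw [map_mul, ← hk, ← hl, ← val_intGL, ← Units.val_mul, hw]
  have h2 := congrArg redMat h1
  rw [map_mul, hk', hl'] at h2
  generalize redMat w.val = v at h2
  have h3 : ((rowUnip i)⁻¹).val * (rowUnip j).val * diagonal (fun s => if s = rowIndex j then 0 else 1)
      = diagonal (fun s => if s = rowIndex i then 0 else 1) * v := by
    rw [Matrix.mul_assoc, ← h2, ← Matrix.mul_assoc, ← Matrix.mul_assoc, ← Units.val_mul,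
      inv_mul_cancel, Units.val_one, Matrix.one_mul]
  -- On the right of `h3` the row `rowIndex i` is annihilated by the projection.
  have h4 : ∀ s, s ≠ rowIndex j → (((rowUnip i)⁻¹).val * (rowUnip j).val) (rowIndex i) s = 0 := by
    intro s hs
    have := congrFun (congrFun h3 (rowIndex i)) s
    rwa [mul_diagonal, diagonal_mul, if_neg hs, if_pos rfl, zero_mul, mul_one] at this
  clear h1 h2 h3 hk hk' hl hl' hij hw key
  rcases i with ⟨b, c⟩ | c | _ <;> rcases j with ⟨b', c'⟩ | c' | _ <;>
    simp [rowUnip, rowIndex, inv_upperGL, val_upperGL, Fin.forall_fin_succ, Matrix.mul_apply,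
      Fin.sum_univ_three] at h4 ⊢
  · exact ⟨by linear_combination -h4.1, by linear_combination -h4.2⟩
  · linear_combination -h4

theorem toVertex_mul_superGL_injective (g : GL (Fin 3) (LocalField K)) :
    Function.Injective fun i => toVertex (g * superGL i) := by
  intro i j hij
  obtain ⟨w, hw⟩ := exists_integral_of_toVertex_eq hij
    (by rw [ordDet_mul, ordDet_mul, ordDet_superGL, ordDet_superGL])
  rw [mul_assoc, mul_right_inj] at hw
  have h1 : constGL ((colUnip j)⁻¹ * colUnip i) * diagT K (Pi.single (colIndex i) 1) =
      diagT K (Pi.single (colIndex j) 1) * intGL w⁻¹ := by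
    rw [map_inv, map_mul, map_inv, eq_mul_inv_iff_mul_eq, mul_assoc, mul_assoc, inv_mul_eq_iff_eq_mul]
    simpa only [superGL, mul_assoc] using hw
  generalize hu : (colUnip j)⁻¹ * colUnip i = u at h1
  generalize w⁻¹ = v at h1
  -- A constant times `t` that is integral must vanish. So, in the basis `colUnip j`, the vector of
  -- `i` is supported on the coordinate of the vector of `j`.
  have h4 : ∀ s, s ≠ colIndex j → u.val s (colIndex i) = 0 := by
    intro s hs
    have h2 := congrArg (fun A : GL (Fin 3) (LocalField K) => A.val s (colIndex i)) h1
    simp only [Units.val_mul, val_diagT, mul_diagonal, diagonal_mul, Pi.single_eq_same, ne_eq, hs,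
      not_false_eq_true, Pi.single_eq_of_ne, zpow_zero, Units.val_one, one_mul, zpow_one] at h2
    have h3 : algebraMap K (LocalField K) (u.val s (colIndex i)) =
        algebraMap (Integers K) (LocalField K) (v.val s (colIndex i) * PowerSeries.X) := by
      rw [map_mul, algebraMap_X]
      have h5 : algebraMap K (LocalField K) (u.val s (colIndex i)) * (tUnit K : LocalField K) =
        algebraMap (Integers K) (LocalField K) (v.val s (colIndex i)) := h2
      rw [← h5, Units.mul_inv_cancel_right]
    rw [← algebraMap_C] at h3
    have h5 := congrArg PowerSeries.constantCoeff (algebraMap_integers_injective h3)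
    simpa using h5
  rw [← hu] at h4
  clear h1 hu hij hw
  rcases i with ⟨b, c⟩ | c | _ <;> rcases j with ⟨b', c'⟩ | c' | _ <;>
    simp [colUnip, colIndex, inv_upperGL, val_upperGL, Fin.forall_fin_succ, Matrix.mul_apply,
      Fin.sum_univ_three] at h4 ⊢
  · exact ⟨by linear_combination h4.1, by linear_combination h4.2⟩
  · linear_combination h4

end Neighbours

/-! ### The fundamental domain of `Γ` and finiteness of stabilizers -/

section Orbits

open Matrix hiding mul_inv_rev zpow_add zpow_neg_one inv_zpow'

variable {K : Type u} [Field K]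

/-- The vertex of the quotient complex represented by `g`. -/
def orbitClass (g : GL (Fin 3) (LocalField K)) : QVertex K := Quotient.mk'' (toVertex g)

theorem orbitClass_surjective : Function.Surjective (orbitClass (K := K)) := by
  intro u
  obtain ⟨x, rfl⟩ := Quotient.mk''_surjective u
  obtain ⟨g, rfl⟩ := toVertex_surjective x
  exact ⟨g, rfl⟩

/-- The element of `Γ` given by a matrix over `𝔽_q[t]`. -/
def gamMk (γ : GL (Fin 3) K[X]) : Gam K := ⟨ProjGenLinGroup.mk (polyGL γ), γ, rfl⟩

theorem gamMk_surjective : Function.Surjective (gamMk (K := K)) := by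
  rintro ⟨_, γ, rfl⟩
  exact ⟨γ, rfl⟩

theorem gamMk_smul_toVertex (γ : GL (Fin 3) K[X]) (g : GL (Fin 3) (LocalField K)) :
    gamMk γ • toVertex g = toVertex (polyGL γ * g) := rfl

theorem orbitClass_polyGL_mul (γ : GL (Fin 3) K[X]) (g : GL (Fin 3) (LocalField K)) :
    orbitClass (polyGL γ * g) = orbitClass g :=
  Quotient.sound' ⟨gamMk γ, rfl⟩

theorem orbitClass_congr {g h : GL (Fin 3) (LocalField K)} (e : toVertex g = toVertex h) :
    orbitClass g = orbitClass h := congrArg Quotient.mk'' e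

theorem orbitClass_eq_iff {g h : GL (Fin 3) (LocalField K)} :
    orbitClass g = orbitClass h ↔ ∃ (γ : GL (Fin 3) K[X]) (w : GL (Fin 3) (Integers K))
      (s : (LocalField K)ˣ),
      polyGL γ * h * intGL w * GeneralLinearGroup.scalar (Fin 3) s = g := by
  constructor
  · intro e
    obtain ⟨γ, hγ⟩ := Quotient.exact' e
    obtain ⟨γ, rfl⟩ := gamMk_surjective γ
    obtain ⟨s, w, h⟩ := toVertex_eq_iff.mp hγ
    exact ⟨γ, w, s, h⟩
  · rintro ⟨γ, w, s, rfl⟩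
    rw [orbitClass_congr (toVertex_mul_scalar _ _), orbitClass_congr (toVertex_mul_intGL _ _),
      orbitClass_polyGL_mul]

theorem color_gam_smul (γ : Gam K) (x : Vertex K) : color (γ • x) = color x := by
  obtain ⟨γ, rfl⟩ := gamMk_surjective γ
  obtain ⟨g, rfl⟩ := toVertex_surjective x
  rw [gamMk_smul_toVertex, color_toVertex, color_toVertex, ordDet_mul, ordDet_polyGL, zero_add]

variable (K) in
/-- The class of the diagonal matrix with the powers `t ^ d i`. -/
def diagClass (d : Fin 3 → ℤ) : QVertex K := orbitClass (diagT K d)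

theorem vtx_eq_diagClass (m n : ℕ) : vtx K m n = diagClass K ![m, n, 0] := by
  have : diagGL (tUnit K ^ m) (tUnit K ^ n) 1 = diagT K ![m, n, 0] := by
    unfold diagT
    simp
  unfold vtx diagClass
  rw [this]
  rfl

theorem diagClass_add_const (d : Fin 3 → ℤ) (a : ℤ) :
    diagClass K (d + fun _ => a) = diagClass K d := by
  unfold diagClass
  rw [diagT_add, diagT_const]
  exact orbitClass_congr (toVertex_mul_scalar _ _)

/-- A permutation matrix. -/
def permGL (R : Type*) [CommRing R] (σ : Equiv.Perm (Fin 3)) : GL (Fin 3) R where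
  val := Matrix.of fun i j => if σ i = j then 1 else 0
  inv := Matrix.of fun i j => if σ j = i then 1 else 0
  val_inv := by
    ext i j
    simp [Matrix.mul_apply, Matrix.one_apply, eq_comm]
  inv_val := by
    ext i j
    rw [Matrix.mul_apply, ← Equiv.sum_comp σ.symm]
    rcases eq_or_ne i j with rfl | h
    · simp
    · simp [h, h.symm]

theorem map_permGL {R S : Type*} [CommRing R] [CommRing S] (f : R →+* S) (σ : Equiv.Perm (Fin 3)) :
    GeneralLinearGroup.map f (permGL R σ) = permGL S σ := by
  ext i j
  simp [permGL, apply_ite f]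

theorem permGL_mul_diagT (σ : Equiv.Perm (Fin 3)) (d : Fin 3 → ℤ) :
    permGL (LocalField K) σ * diagT K d = diagT K (d ∘ σ) * permGL (LocalField K) σ := by
  refine GeneralLinearGroup.ext fun i j => ?_
  rw [Units.val_mul, Units.val_mul, val_diagT, val_diagT, mul_diagonal, diagonal_mul]
  by_cases h : σ i = j
  · subst h
    simp [permGL]
  · simp [permGL, h]

theorem diagClass_comp_perm (σ : Equiv.Perm (Fin 3)) (d : Fin 3 → ℤ) :
    diagClass K (d ∘ σ) = diagClass K d := by
  refine orbitClass_eq_iff.mpr ⟨permGL _ σ, (permGL _ σ)⁻¹, 1, ?_⟩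
  rw [polyGL, intGL, map_inv, map_permGL, map_permGL, permGL_mul_diagT]
  simp

/-- Conjugation multiplies the entry at `(i, j)`, `i < j`, by `t^{d i - d j}`, which is a polynomial
exactly because `d` is decreasing. -/
theorem diagT_mul_upperGL {d : Fin 3 → ℤ} (hd : Antitone d) (a b c : K) :
    ∃ γ, diagT K d * constGL (upperGL a b c) = polyGL γ * diagT K d := by
  have key : ∀ (a : K) (i j : Fin 3), i ≤ j →
      ((tUnit K ^ d i : (LocalField K)ˣ) : LocalField K) * algebraMap K (LocalField K) a =
      polyEmb K (Polynomial.C a * Polynomial.X ^ (d i - d j).toNat) *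
        ((tUnit K ^ d j : (LocalField K)ˣ) : LocalField K) := by
    intro a i j hij
    rw [map_mul, map_pow, polyEmb_C, polyEmb_X, ← Units.val_pow_eq_pow_val, mul_assoc,
      ← Units.val_mul, ← zpow_natCast, Int.toNat_of_nonneg (sub_nonneg.mpr (hd hij)), ← zpow_add,
      sub_add_cancel, mul_comm]
  refine ⟨upperGL (Polynomial.C a * Polynomial.X ^ (d 0 - d 1).toNat)
    (Polynomial.C b * Polynomial.X ^ (d 0 - d 2).toNat)
    (Polynomial.C c * Polynomial.X ^ (d 1 - d 2).toNat), ?_⟩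
  rw [constGL, polyGL, map_upperGL, map_upperGL]
  refine GeneralLinearGroup.ext fun i j => ?_
  rw [Units.val_mul, Units.val_mul, val_diagT, mul_diagonal, diagonal_mul, val_upperGL, val_upperGL]
  have h01 := key a 0 1 (by decide)
  have h02 := key b 0 2 (by decide)
  have h12 := key c 1 2 (by decide)
  fin_cases i <;> fin_cases j <;> first | exact h01 | exact h02 | exact h12 | simp

theorem orbitClass_diagT_mul_upperGL {d : Fin 3 → ℤ} (hd : Antitone d) (a b c : K)
    (e : Fin 3 → ℤ) :
    orbitClass (diagT K d * (constGL (upperGL a b c) * diagT K e)) = diagClass K (d + e) := by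
  obtain ⟨γ, hγ⟩ := diagT_mul_upperGL hd a b c
  rw [← mul_assoc, hγ, mul_assoc, orbitClass_polyGL_mul, ← diagT_add, diagClass]

theorem orbitClass_diagT_mul_subGL {d : Fin 3 → ℤ} (hd : Antitone d) (i : PlanePoint K) :
    orbitClass (diagT K d * subGL i) = diagClass K (d - Pi.single (rowIndex i) 1) := by
  rw [sub_eq_add_neg]
  rcases i with ⟨b, c⟩ | c | _ <;> exact orbitClass_diagT_mul_upperGL hd _ _ _ _

theorem orbitClass_diagT_mul_superGL {d : Fin 3 → ℤ} (hd : Antitone d) (i : PlanePoint K) :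
    orbitClass (diagT K d * superGL i) = diagClass K (d + Pi.single (colIndex i) 1) := by
  rcases i with ⟨b, c⟩ | c | _ <;> exact orbitClass_diagT_mul_upperGL hd _ _ _ _

theorem exists_antitone_diagClass_eq (d : Fin 3 → ℤ) :
    ∃ d', Antitone d' ∧ diagClass K d = diagClass K d' := by
  refine ⟨d ∘ Tuple.sort (-d), ?_, (diagClass_comp_perm _ _).symm⟩
  have h := Tuple.monotone_sort (-d)
  intro i j hij
  have := h hij
  simpa using this

/-- Write `g` as `γ · diag · w · s`. The factor `w` only permutes the sublattices of index `q`, so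
the new lattice is `Γ`-equivalent to a neighbour of a dominant diagonal one. -/
theorem exists_diagClass_mul_subGL {g : GL (Fin 3) (LocalField K)}
    (hg : ∃ d, orbitClass g = diagClass K d) (i : PlanePoint K) :
    ∃ d, orbitClass (g * subGL i) = diagClass K d := by
  obtain ⟨d, hd⟩ := hg
  obtain ⟨d', hd', e⟩ := exists_antitone_diagClass_eq (K := K) d
  rw [e] at hd
  obtain ⟨γ, w, s, rfl⟩ := orbitClass_eq_iff.mp hd
  obtain ⟨j, hj⟩ := exists_isIntegral_subGL_inv_mul
    ((isIntegral_intGL w).mul (isIntegral_subGL i))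
    (by rw [ordDet_mul, ordDet_intGL, ordDet_subGL]; norm_num)
  obtain ⟨w', hw'⟩ := hj.exists_eq
    (by rw [ordDet_mul, ordDet_inv, ordDet_mul, ordDet_intGL, ordDet_subGL, ordDet_subGL]; norm_num)
  refine ⟨d' - Pi.single (rowIndex j) 1, ?_⟩
  rw [← orbitClass_diagT_mul_subGL hd', orbitClass_eq_iff]
  refine ⟨γ, w', s, ?_⟩
  rw [hw', mul_assoc _ (GeneralLinearGroup.scalar (Fin 3) s), GeneralLinearGroup.scalar_commute]
  group

/-- Every sublattice is reached by a chain of steps of index `q`, each of which preserves the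
diagonal classes. -/
theorem exists_diagClass_mul_of_isIntegral (n : ℕ) :
    ∀ h g : GL (Fin 3) (LocalField K), IsIntegral h → ordDet h = n →
      (∃ d, orbitClass g = diagClass K d) → ∃ d, orbitClass (g * h) = diagClass K d := by
  induction n with
  | zero =>
    rintro h g hh hn ⟨d, hd⟩
    obtain ⟨w, rfl⟩ := hh.exists_eq (by simpa using hn)
    exact ⟨d, by rw [orbitClass_congr (toVertex_mul_intGL _ _), hd]⟩
  | succ n ih =>
    intro h g hh hn hg
    obtain ⟨i, hi⟩ := exists_isIntegral_subGL_inv_mul hh (by rw [hn]; positivity)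
    have := ih _ _ hi (by rw [ordDet_mul, ordDet_inv, ordDet_subGL, hn]; push_cast; ring)
      (exists_diagClass_mul_subGL hg i)
    rwa [mul_assoc, mul_inv_cancel_left] at this

theorem exists_isIntegral_mul_scalar (g : GL (Fin 3) (LocalField K)) :
    ∃ N : ℕ, IsIntegral (g * GeneralLinearGroup.scalar (Fin 3) (tUnit K ^ (-(N : ℤ)))) := by
  let N : ℕ := Finset.univ.sup fun p : Fin 3 × Fin 3 => (HahnSeries.order (g.val p.1 p.2)).natAbs
  have hN : ∀ i j, (HahnSeries.order (g.val i j)).natAbs ≤ N := fun i j =>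
    Finset.le_sup (f := fun p : Fin 3 × Fin 3 => (HahnSeries.order (g.val p.1 p.2)).natAbs)
      (Finset.mem_univ (i, j))
  have h : ∀ i j, ∃ p : Integers K, algebraMap (Integers K) (LocalField K) p =
      g.val i j * ((tUnit K ^ (-(N : ℤ)) : (LocalField K)ˣ) : LocalField K) := by
    intro i j
    apply exists_algebraMap_of_order_nonneg
    by_cases h0 : g.val i j = 0
    · rw [h0, zero_mul, HahnSeries.order_zero]
    · rw [HahnSeries.order_mul h0 (Units.ne_zero _), order_tUnit_zpow]
      have := hN i j
      omega
  choose p hp using h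
  refine ⟨N, Matrix.of p, ?_⟩
  rw [Units.val_mul, GeneralLinearGroup.coe_scalar, scalar_apply]
  ext i j : 2
  rw [mul_diagonal, ← hp]
  rfl

theorem exists_orbitClass_eq_diagClass (g : GL (Fin 3) (LocalField K)) :
    ∃ d, orbitClass g = diagClass K d := by
  obtain ⟨N, hN⟩ := exists_isIntegral_mul_scalar g
  obtain ⟨n, hn⟩ := Int.eq_ofNat_of_zero_le hN.ordDet_nonneg
  have := exists_diagClass_mul_of_isIntegral n _ 1 hN hn ⟨0, by rw [diagClass, diagT_zero]⟩
  rwa [one_mul, orbitClass_congr (toVertex_mul_scalar _ _)] at this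

theorem exists_eq_vtx (u : QVertex K) : ∃ m n : ℕ, n ≤ m ∧ u = vtx K m n := by
  obtain ⟨g, rfl⟩ := orbitClass_surjective u
  obtain ⟨d, hd⟩ := exists_orbitClass_eq_diagClass g
  obtain ⟨d', hd', e⟩ := exists_antitone_diagClass_eq (K := K) d
  have h01 : d' 1 ≤ d' 0 := hd' (by decide)
  have h12 : d' 2 ≤ d' 1 := hd' (by decide)
  refine ⟨(d' 0 - d' 2).toNat, (d' 1 - d' 2).toNat, by omega, ?_⟩
  rw [hd, e, vtx_eq_diagClass, ← diagClass_add_const d' (-d' 2)]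
  congr 1
  ext i
  fin_cases i <;> simp <;> omega

theorem order_polyEmb_nonpos (p : K[X]) : (polyEmb K p).order ≤ 0 := by
  by_contra h
  push Not at h
  have h0 : p = 0 := by
    ext n
    rw [Polynomial.coeff_zero]
    exact coeff_eq_zero_of_lt_order_polyEmb (by omega)
  simp [h0] at h

/-- A nonzero entry of `γ` has order at most 0 and an entry of `w⁻¹` order at least 0, so `γ i j ≠
0` gives `d' j ≤ d i + ℓ`. A nonzero term of `det γ` gives this along a permutation, and comparing
the sums turns the inequalities into equalities. -/
theorem exists_perm_of_diagClass_eq {d d' : Fin 3 → ℤ} (h : diagClass K d = diagClass K d') :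
    ∃ (σ : Equiv.Perm (Fin 3)) (s : ℤ), ∀ j, d' j = d (σ j) + s := by
  obtain ⟨γ, w, s, e⟩ := orbitClass_eq_iff.mp h
  have hsum := congrArg ordDet e
  rw [ordDet_mul, ordDet_mul, ordDet_mul, ordDet_polyGL, ordDet_intGL, ordDet_scalar,
    ordDet_diagT, ordDet_diagT] at hsum
  set ℓ := HahnSeries.order (s : LocalField K) with hℓ
  have e' : polyGL γ * diagT K d' * GeneralLinearGroup.scalar (Fin 3) s =
      diagT K d * intGL w⁻¹ := by
    rw [map_inv, eq_mul_inv_iff_mul_eq, ← e, mul_assoc, GeneralLinearGroup.scalar_commute,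
      ← mul_assoc]
  have hle : ∀ i j, γ.val i j ≠ 0 → d' j ≤ d i + ℓ := by
    intro i j hij
    have h1 := congrArg (fun A : GL (Fin 3) (LocalField K) => A.val i j) e'
    simp only [Units.val_mul, val_diagT, GeneralLinearGroup.coe_scalar, scalar_apply,
      mul_diagonal, diagonal_mul] at h1
    have h2 : polyEmb K (γ.val i j) * ((tUnit K ^ d' j : (LocalField K)ˣ) : LocalField K) * s =
      ((tUnit K ^ d i : (LocalField K)ˣ) : LocalField K) *
        algebraMap (Integers K) (LocalField K) ((w⁻¹).val i j) := h1
    have h3 : polyEmb K (γ.val i j) ≠ 0 := (map_ne_zero_iff _ polyEmb_injective).mpr hij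
    have h4 : algebraMap (Integers K) (LocalField K) ((w⁻¹).val i j) ≠ 0 := by
      intro h0
      rw [h0, mul_zero] at h2
      exact mul_ne_zero (mul_ne_zero h3 (Units.ne_zero _)) (Units.ne_zero _) h2
    have h5 := congrArg HahnSeries.order h2
    rw [HahnSeries.order_mul (mul_ne_zero h3 (Units.ne_zero _)) (Units.ne_zero _),
      HahnSeries.order_mul h3 (Units.ne_zero _), HahnSeries.order_mul (Units.ne_zero _) h4,
      order_tUnit_zpow, order_tUnit_zpow] at h5
    have h6 := order_polyEmb_nonpos (γ.val i j)
    have h7 := order_algebraMap_nonneg ((w⁻¹).val i j)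
    omega
  have hdet : γ.val.det ≠ 0 := GeneralLinearGroup.det_ne_zero γ
  rw [det_apply] at hdet
  obtain ⟨σ, -, hσ⟩ := Finset.exists_ne_zero_of_sum_ne_zero hdet
  have hprod : ∀ j, γ.val (σ j) j ≠ 0 := by
    intro j hj
    apply hσ
    have h0 : ∏ i, γ.val (σ i) i = 0 := Finset.prod_eq_zero (Finset.mem_univ j) hj
    exact (congrArg _ h0).trans (smul_zero _)
  have hs := Equiv.sum_comp σ d
  rw [Fin.sum_univ_three, Fin.sum_univ_three] at hs
  have h0 := hle _ _ (hprod 0)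
  have h1 := hle _ _ (hprod 1)
  have h2 := hle _ _ (hprod 2)
  refine ⟨σ, ℓ, fun j => ?_⟩
  fin_cases j <;> simp <;> omega

theorem vtx_injective {m n m' n' : ℕ} (h : n ≤ m) (h' : n' ≤ m') (e : vtx K m n = vtx K m' n') :
    m = m' ∧ n = n' := by
  rw [vtx_eq_diagClass, vtx_eq_diagClass] at e
  obtain ⟨σ, s, hσ⟩ := exists_perm_of_diagClass_eq e
  have h0 := hσ 0
  have h1 := hσ 1
  have h2 := hσ 2
  have n01 : σ 0 ≠ σ 1 := by simp
  have n02 : σ 0 ≠ σ 2 := by simp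
  have n12 : σ 1 ≠ σ 2 := by simp
  generalize σ 0 = a at *
  generalize σ 1 = b at *
  generalize σ 2 = c at *
  clear hσ e
  fin_cases a <;> fin_cases b <;> fin_cases c <;> simp at h0 h1 h2 n01 n02 n12 <;> omega

theorem finite_natDegree_le [Finite K] (M : ℕ) : {p : K[X] | p.natDegree ≤ M}.Finite := by
  have : Finite (Polynomial.degreeLT K (M + 1)) := Module.finite_of_finite K
  refine Set.Finite.subset (Set.toFinite (Polynomial.degreeLT K (M + 1) : Set K[X])) fun p hp => ?_
  rw [SetLike.mem_coe, Polynomial.mem_degreeLT]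
  exact lt_of_le_of_lt Polynomial.degree_le_natDegree (by exact_mod_cast Nat.lt_succ_of_le hp)

theorem conj_mul_of_central {H : Type*} [Group H] {a : H} (ha : ∀ x, a * x = x * a) (b g w : H) :
    g * w * g⁻¹ * (a * b) = g * a * w * (g⁻¹ * b) := by
  have h := ha (w * g⁻¹)
  simp only [mul_assoc] at h ⊢
  rw [← mul_assoc g⁻¹ a b, ← mul_assoc w, ← mul_assoc w g⁻¹ b, ← mul_assoc a, ha]
  simp only [mul_assoc]

/-- A stabilizing matrix has the form `g w g⁻¹` with `w` integral, so the degrees of its entries are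
bounded in terms of `g`. Finiteness matters because `Nat.card` of an infinite stabilizer would be 0
and the weight would vanish. -/
theorem finite_stabilizer_toVertex [Finite K] (g : GL (Fin 3) (LocalField K)) :
    Finite (MulAction.stabilizer (Gam K) (toVertex g)) := by
  obtain ⟨N, k, hk⟩ := exists_isIntegral_mul_scalar g
  obtain ⟨N', k', hk'⟩ := exists_isIntegral_mul_scalar g⁻¹
  let S : Set (GL (Fin 3) K[X]) := {A | ∀ i j, (A.val i j).natDegree ≤ N + N'}
  have hS : S.Finite := by
    have h1 : {f : Fin 3 → Fin 3 → K[X] | ∀ i, f i ∈ {r : Fin 3 → K[X] | ∀ j, r j ∈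
        {p : K[X] | p.natDegree ≤ N + N'}}}.Finite :=
      Set.Finite.pi' fun _ => Set.Finite.pi' fun _ => finite_natDegree_le _
    refine Set.Finite.of_finite_image (f := fun A : GL (Fin 3) K[X] => A.val)
      (h1.subset ?_) Units.val_injective.injOn
    rintro _ ⟨A, hA, rfl⟩
    exact hA
  refine Set.Finite.to_subtype (Set.Finite.subset (hS.image gamMk) fun γ hγ => ?_)
  obtain ⟨A, rfl⟩ := gamMk_surjective γ
  refine ⟨A, fun i j => ?_, rfl⟩
  have h1 : toVertex g = toVertex (polyGL A * g) := (MulAction.mem_stabilizer_iff.mp hγ).symm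
  obtain ⟨w, hw⟩ := exists_integral_of_toVertex_eq h1
    (by rw [ordDet_mul, ordDet_polyGL, zero_add])
  have h2 : polyGL A * GeneralLinearGroup.scalar (Fin 3) (tUnit K ^ (-((N + N' : ℕ) : ℤ))) =
      g * GeneralLinearGroup.scalar (Fin 3) (tUnit K ^ (-(N : ℤ))) * intGL w *
        (g⁻¹ * GeneralLinearGroup.scalar (Fin 3) (tUnit K ^ (-(N' : ℤ)))) := by
    have h3 : polyGL A = g * intGL w * g⁻¹ := by rw [hw]; group
    rw [h3, Nat.cast_add, neg_add, zpow_add, map_mul]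
    exact conj_mul_of_central (GeneralLinearGroup.scalar_commute _) _ _ _
  obtain ⟨l, hl⟩ : IsIntegral
      (polyGL A * GeneralLinearGroup.scalar (Fin 3) (tUnit K ^ (-((N + N' : ℕ) : ℤ)))) := by
    rw [h2]
    exact (IsIntegral.mul ⟨k, hk⟩ (isIntegral_intGL w)).mul ⟨k', hk'⟩
  rw [Units.val_mul, GeneralLinearGroup.coe_scalar, scalar_apply] at hl
  have h4 := congrFun (congrFun hl i) j
  rw [mul_diagonal] at h4
  have h5 : polyEmb K (A.val i j) *
      ((tUnit K ^ (-((N + N' : ℕ) : ℤ)) : (LocalField K)ˣ) : LocalField K) =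
      algebraMap (Integers K) (LocalField K) (l i j) := h4
  by_cases h0 : A.val i j = 0
  · rw [h0, Polynomial.natDegree_zero]
    exact Nat.zero_le _
  have h6 : 0 ≤ (algebraMap (Integers K) (LocalField K) (l i j)).order := order_algebraMap_nonneg _
  rw [← h5, HahnSeries.order_mul ((map_ne_zero_iff _ polyEmb_injective).mpr h0) (Units.ne_zero _),
    order_tUnit_zpow] at h6
  by_contra hlt
  push Not at hlt
  have h7 := coeff_eq_zero_of_lt_order_polyEmb (p := A.val i j) (n := (A.val i j).natDegree)
    (by omega)
  exact h0 (Polynomial.leadingCoeff_eq_zero.mp h7)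

theorem finite_stabilizer [Finite K] (x : Vertex K) : Finite (MulAction.stabilizer (Gam K) x) := by
  obtain ⟨g, rfl⟩ := toVertex_surjective x
  exact finite_stabilizer_toVertex g

end Orbits

/-! ### Edges of the quotient and orbits of vertex stabilizers -/

section AdjacencyOperator

variable {K : Type u} [Field K]

/-- The neighbours of a vertex of the building whose color is larger by `i`. -/
def neighbours (i : ZMod 3) (x : Vertex K) : Set (Vertex K) :=
  {y | Adj x y ∧ color y = color x + i}

theorem neighbours_one (g : GL (Fin 3) (LocalField K)) :
    neighbours 1 (toVertex g) = Set.range fun i => toVertex (g * subGL i) := by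
  ext y
  exact (adj_color_add_one_iff g y).trans (exists_congr fun i => eq_comm)

theorem neighbours_neg_one (g : GL (Fin 3) (LocalField K)) :
    neighbours (-1) (toVertex g) = Set.range fun i => toVertex (g * superGL i) := by
  ext y
  exact (adj_color_sub_one_iff g y).trans (exists_congr fun i => eq_comm)

theorem finite_neighbours [Finite K] {i : ZMod 3} (hi : i = 1 ∨ i = -1) (x : Vertex K) :
    (neighbours i x).Finite := by
  obtain ⟨g, rfl⟩ := toVertex_surjective x
  rcases hi with rfl | rfl
  · rw [neighbours_one]
    exact Set.finite_range _
  · rw [neighbours_neg_one]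
    exact Set.finite_range _

theorem smul_mem_neighbours {i : ZMod 3} {x y : Vertex K} (γ : Gam K) (h : y ∈ neighbours i x) :
    γ • y ∈ neighbours i (γ • x) := by
  refine ⟨h.1.smul γ, ?_⟩
  rw [color_gam_smul, color_gam_smul, h.2]

/-- The orbit of a pair of vertices. -/
def pairClass (x y : Vertex K) : QPair K := Quotient.mk'' (x, y)

theorem mem_edgesFrom_iff {i : ZMod 3} {x : Vertex K} {e : QPair K} :
    e ∈ edgesFrom i (Quotient.mk'' x) ↔ ∃ y ∈ neighbours i x, pairClass x y = e := by
  constructor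
  · rintro ⟨x', y, rfl, hx, hadj, hcol⟩
    obtain ⟨γ, hγ⟩ := Quotient.exact' hx
    have hγ : γ • x = x' := hγ
    subst hγ
    refine ⟨γ⁻¹ • y, ?_, ?_⟩
    · have := smul_mem_neighbours γ⁻¹ (show y ∈ neighbours i (γ • x) from ⟨hadj, hcol⟩)
      rwa [inv_smul_smul] at this
    · refine Quotient.sound' ⟨γ⁻¹, ?_⟩
      change (γ⁻¹ • γ • x, γ⁻¹ • y) = _
      rw [inv_smul_smul]
  · rintro ⟨y, hy, rfl⟩
    exact ⟨x, y, rfl, rfl, hy.1, hy.2⟩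

theorem pairClass_fiber {i : ZMod 3} {x y : Vertex K} (hy : y ∈ neighbours i x) :
    {z | z ∈ neighbours i x ∧ pairClass x z = pairClass x y} =
      MulAction.orbit (MulAction.stabilizer (Gam K) x) y := by
  ext z
  constructor
  · rintro ⟨-, hz⟩
    obtain ⟨γ, hγ⟩ := Quotient.exact' hz
    have hγ : (γ • x, γ • y) = (x, z) := hγ
    rw [Prod.mk.injEq] at hγ
    exact ⟨⟨γ, hγ.1⟩, hγ.2⟩
  · rintro ⟨⟨γ, hγ⟩, rfl⟩
    have hγ : γ • x = x := hγ
    refine ⟨?_, Quotient.sound' ⟨γ, ?_⟩⟩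
    · have := smul_mem_neighbours γ hy
      rwa [hγ] at this
    · change (γ • x, γ • y) = _
      rw [hγ]
      rfl

theorem card_stabilizer_eq (x y : Vertex K) :
    Nat.card (MulAction.stabilizer (Gam K) x) =
      Nat.card (MulAction.stabilizer (Gam K) (x, y)) *
        (MulAction.orbit (MulAction.stabilizer (Gam K) x) y).ncard := by
  rw [← MulAction.index_stabilizer,
    ← Subgroup.card_mul_index (MulAction.stabilizer (MulAction.stabilizer (Gam K) x) y)]
  congr 1
  refine Nat.card_congr ⟨fun γ => ⟨γ.1.1, Prod.ext γ.1.2 γ.2⟩,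
    fun γ => ⟨⟨γ.1, congrArg Prod.fst γ.2⟩, congrArg Prod.snd γ.2⟩, fun _ => rfl, fun _ => rfl⟩

end AdjacencyOperator

/-! ### Weight ratios as neighbour counts, and the operators on diagonal classes -/

section Weights

variable {K : Type u} [Field K] [Fintype K]

variable (K) in
/-- The numerator of the weights. -/
def weightConst : ℝ :=
  (Fintype.card K : ℝ) ^ 3 * ((Fintype.card K : ℝ) + 1) * ((Fintype.card K : ℝ) - 1) ^ 2

variable (K) in
theorem one_lt_card : (1 : ℝ) < Fintype.card K := by exact_mod_cast Fintype.one_lt_card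

variable (K) in
theorem weightConst_pos : 0 < weightConst K := by
  have h := one_lt_card K
  have h1 : 0 < (Fintype.card K : ℝ) - 1 := by linarith
  unfold weightConst
  positivity

theorem weight_mk {X : Type u} [MulAction (Gam K) X] (x : X) :
    weight (Quotient.mk'' x : MulAction.orbitRel.Quotient (Gam K) X) =
      weightConst K / (Nat.card (MulAction.stabilizer (Gam K) x) : ℝ) := rfl

theorem card_stabilizer_pos (x : Vertex K) : 0 < Nat.card (MulAction.stabilizer (Gam K) x) := by
  have := finite_stabilizer x
  exact Nat.card_pos

theorem weight_pos (u : QVertex K) : 0 < weight u := by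
  obtain ⟨x, rfl⟩ := Quotient.mk''_surjective u
  rw [weight_mk]
  exact div_pos (weightConst_pos K) (by exact_mod_cast card_stabilizer_pos x)

/-- The quotient of weights is the index of `Γ_x ∩ Γ_y` in `Γ_x`, the size of the `Γ_x`-orbit of
`y`. -/
theorem weight_pairClass_div {i : ZMod 3} {x y : Vertex K} (hy : y ∈ neighbours i x) :
    weight (pairClass x y) / weight (Quotient.mk'' x : QVertex K) =
      ({z | z ∈ neighbours i x ∧ pairClass x z = pairClass x y}.ncard : ℝ) := by
  rw [pairClass_fiber hy]
  unfold pairClass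
  rw [weight_mk, weight_mk]
  have h := card_stabilizer_eq x y
  have hpos := card_stabilizer_pos x
  rw [h] at hpos ⊢
  have h1 : (Nat.card (MulAction.stabilizer (Gam K) (x, y)) : ℝ) ≠ 0 := by
    exact_mod_cast (Nat.pos_of_mul_pos_right hpos).ne'
  have h2 := (weightConst_pos K).ne'
  push_cast
  field_simp

theorem finsum_edgesFrom {i : ZMod 3} {x : Vertex K} (hfin : (neighbours i x).Finite)
    (F : QPair K → ℂ) :
    ∑ᶠ e ∈ edgesFrom i (Quotient.mk'' x),
      ((weight e / weight (Quotient.mk'' x : QVertex K) : ℝ) : ℂ) * F e =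
      ∑ y ∈ hfin.toFinset, F (pairClass x y) := by
  classical
  rw [Finset.sum_comp F (pairClass x)]
  have hset : edgesFrom i (Quotient.mk'' x : QVertex K) =
      (hfin.toFinset.image (pairClass x) : Finset (QPair K)) := by
    ext e
    rw [mem_edgesFrom_iff]
    simp
  rw [hset, finsum_mem_coe_finset]
  refine Finset.sum_congr rfl fun e he => ?_
  obtain ⟨y, hy, rfl⟩ := Finset.mem_image.mp he
  rw [Set.Finite.mem_toFinset] at hy
  rw [weight_pairClass_div hy, nsmul_eq_mul, Complex.ofReal_natCast, ← Set.ncard_coe_finset]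
  congr 3
  ext z
  simp

theorem adjOp_mk {i : ZMod 3} {x : Vertex K} (hfin : (neighbours i x).Finite)
    (f : QVertex K → ℂ) :
    adjOp i f (Quotient.mk'' x) = ∑ y ∈ hfin.toFinset, f (Quotient.mk'' y) :=
  finsum_edgesFrom hfin fun e => f (target e)

theorem adjOp_one_orbitClass (f : QVertex K → ℂ) (g : GL (Fin 3) (LocalField K)) :
    adjOp 1 f (orbitClass g) = ∑ i : PlanePoint K, f (orbitClass (g * subGL i)) := by
  classical
  have h := adjOp_mk (finite_neighbours (Or.inl rfl) (toVertex g)) f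
  have hs : (finite_neighbours (Or.inl rfl) (toVertex g)).toFinset =
      Finset.univ.image fun i => toVertex (g * subGL i) := by
    ext y
    rw [Set.Finite.mem_toFinset, neighbours_one]
    simp
  rw [hs, Finset.sum_image (toVertex_mul_subGL_injective g).injOn] at h
  exact h

theorem adjOp_neg_one_orbitClass (f : QVertex K → ℂ) (g : GL (Fin 3) (LocalField K)) :
    adjOp (-1) f (orbitClass g) = ∑ i : PlanePoint K, f (orbitClass (g * superGL i)) := by
  classical
  have h := adjOp_mk (finite_neighbours (Or.inr rfl) (toVertex g)) f
  have hs : (finite_neighbours (Or.inr rfl) (toVertex g)).toFinset =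
      Finset.univ.image fun i => toVertex (g * superGL i) := by
    ext y
    rw [Set.Finite.mem_toFinset, neighbours_neg_one]
    simp
  rw [hs, Finset.sum_image (toVertex_mul_superGL_injective g).injOn] at h
  exact h

/-- The class of a neighbour depends only on the cell of its normal form, and the cells have `q²`,
`q` and `1` elements. -/
theorem adjOp_one_diagClass (f : QVertex K → ℂ) {d : Fin 3 → ℤ} (hd : Antitone d) :
    adjOp 1 f (diagClass K d) = (Fintype.card K : ℂ) ^ 2 * f (diagClass K (d - Pi.single 0 1)) +
      Fintype.card K * f (diagClass K (d - Pi.single 1 1)) +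
      f (diagClass K (d - Pi.single 2 1)) := by
  rw [diagClass, adjOp_one_orbitClass]
  simp_rw [orbitClass_diagT_mul_subGL hd]
  simp [Fintype.sum_sum_type, rowIndex, sq, add_assoc]

theorem adjOp_neg_one_diagClass (f : QVertex K → ℂ) {d : Fin 3 → ℤ} (hd : Antitone d) :
    adjOp (-1) f (diagClass K d) = f (diagClass K (d + Pi.single 0 1)) +
      Fintype.card K * f (diagClass K (d + Pi.single 1 1)) +
      (Fintype.card K : ℂ) ^ 2 * f (diagClass K (d + Pi.single 2 1)) := by
  rw [diagClass, adjOp_neg_one_orbitClass]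
  simp_rw [orbitClass_diagT_mul_superGL hd]
  simp [Fintype.sum_sum_type, colIndex, sq]
  ring

end Weights

/-! ### The operators as kernels, and detailed balance -/

section Kernel

variable {K : Type u} [Field K]

/-- The number of neighbours of a representative of `u` that lie over `v` and have color larger
by `i`. -/
def kernel (i : ZMod 3) (u v : QVertex K) : ℝ :=
  ({y | y ∈ neighbours i u.out ∧ Quotient.mk'' y = v}.ncard : ℝ)

theorem kernel_nonneg (i : ZMod 3) (u v : QVertex K) : 0 ≤ kernel i u v := Nat.cast_nonneg _

/-- Reversal of the oriented edges. -/
def reverse (e : QPair K) : QPair K :=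
  Quotient.map' Prod.swap (by
    rintro a b ⟨γ, hγ⟩
    exact ⟨γ, by rw [← hγ]; rfl⟩) e

theorem reverse_reverse (e : QPair K) : reverse (reverse e) = e := by
  obtain ⟨⟨x, y⟩, rfl⟩ := Quotient.mk''_surjective e
  rfl

theorem reverse_mem {i : ZMod 3} {u v : QVertex K} {e : QPair K}
    (he : e ∈ edgesFrom i u ∩ {e | target e = v}) :
    reverse e ∈ edgesFrom (-i) v ∩ {e | target e = u} := by
  obtain ⟨⟨x, y, rfl, rfl, hadj, hcol⟩, rfl⟩ := he
  exact ⟨⟨y, x, rfl, rfl, hadj.symm, by rw [hcol]; ring⟩, rfl⟩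

variable [Fintype K]

/-- No growth condition on `f` is needed: each row of the kernel has finite support. -/
theorem hasSum_kernel_mul {i : ZMod 3} (hi : i = 1 ∨ i = -1) (f : QVertex K → ℂ)
    (u : QVertex K) : HasSum (fun v => (kernel i u v : ℂ) * f v) (adjOp i f u) := by
  classical
  have hfin := finite_neighbours hi u.out
  have h1 : adjOp i f u = ∑ y ∈ hfin.toFinset, f (Quotient.mk'' y) := by
    rw [← adjOp_mk]
    congr 1
    exact (Quotient.out_eq' u).symm
  rw [h1, Finset.sum_comp f (fun y : Vertex K => (Quotient.mk'' y : QVertex K))]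
  have h2 : ∀ v, kernel i u v =
      ((hfin.toFinset.filter fun y : Vertex K => (Quotient.mk'' y : QVertex K) = v).card : ℝ) := by
    intro v
    rw [kernel, ← Set.ncard_coe_finset]
    congr 2
    ext z
    simp
  have h3 : ∀ v, v ∉ hfin.toFinset.image (fun y : Vertex K => (Quotient.mk'' y : QVertex K)) →
      (kernel i u v : ℂ) * f v = 0 := by
    intro v hv
    rw [h2, Finset.filter_eq_empty_iff.mpr]
    · simp
    · intro y hy hyv
      exact hv (Finset.mem_image.mpr ⟨y, hy, hyv⟩)
  have h4 := hasSum_sum_of_ne_finset_zero (L := .unconditional _) h3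
  simp_rw [h2, Complex.ofReal_natCast, ← nsmul_eq_mul] at h4
  simp_rw [h2, Complex.ofReal_natCast, ← nsmul_eq_mul]
  exact h4

theorem adjOp_single {i : ZMod 3} (hi : i = 1 ∨ i = -1) [DecidableEq (QVertex K)]
    (u v : QVertex K) : adjOp i (Pi.single v 1) u = kernel i u v := by
  refine (hasSum_kernel_mul hi (Pi.single v 1) u).unique ?_
  convert hasSum_single v ?_ using 1
  · simp
  · intro v' hv'
    simp [hv']

theorem weight_reverse (e : QPair K) : weight (reverse e) = weight e := by
  obtain ⟨⟨x, y⟩, rfl⟩ := Quotient.mk''_surjective e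
  change weight (pairClass y x) = weight (pairClass x y)
  unfold pairClass
  rw [weight_mk, weight_mk]
  congr 2
  exact Nat.card_congr ⟨fun γ => ⟨γ.1, Prod.ext (congrArg Prod.snd γ.2) (congrArg Prod.fst γ.2)⟩,
    fun γ => ⟨γ.1, Prod.ext (congrArg Prod.snd γ.2) (congrArg Prod.fst γ.2)⟩,
    fun _ => rfl, fun _ => rfl⟩

theorem weight_mul_adjOp_single [DecidableEq (QVertex K)] (i : ZMod 3) (u v : QVertex K) :
    (weight u : ℂ) * adjOp i (Pi.single v 1) u =
      ∑ᶠ e ∈ edgesFrom i u ∩ {e | target e = v}, (weight e : ℂ) := by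
  have hu : (weight u : ℂ) ≠ 0 := by exact_mod_cast (weight_pos u).ne'
  unfold adjOp
  rw [← smul_eq_mul, smul_finsum]
  refine finsum_congr fun e => ?_
  by_cases h1 : e ∈ edgesFrom i u
  · by_cases h2 : target e = v
    · simp only [h1, h2, finsum_true, smul_eq_mul, Set.mem_inter_iff, Set.mem_ofPred_eq, and_self,
        Pi.single_eq_same, mul_one, Complex.ofReal_div]
      field_simp
    · simp [h1, h2]
  · simp [h1]

/-- Both sides are the total weight of the edges between `u` and `v`; reversing edges preserves the
weight and negates the colour step. -/
theorem weight_mul_kernel {i : ZMod 3} (hi : i = 1 ∨ i = -1) (u v : QVertex K) :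
    weight u * kernel i u v = weight v * kernel (-i) v u := by
  classical
  have hi' : -i = 1 ∨ -i = -1 := by rcases hi with rfl | rfl <;> simp
  have h : (weight u : ℂ) * adjOp i (Pi.single v 1) u =
      (weight v : ℂ) * adjOp (-i) (Pi.single u 1) v := by
    rw [weight_mul_adjOp_single, weight_mul_adjOp_single]
    refine finsum_mem_eq_of_bijOn reverse ⟨fun e he => reverse_mem he, ?_, ?_⟩ fun e _ => ?_
    · intro e _ e' _ h
      rw [← reverse_reverse e, h, reverse_reverse]
    · intro e he
      refine ⟨reverse e, ?_, reverse_reverse e⟩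
      have := reverse_mem he
      rwa [neg_neg] at this
    · rw [weight_reverse]
  rw [adjOp_single hi, adjOp_single hi'] at h
  exact_mod_cast h

end Kernel

/-! ### Eigenfunctions of a normal pair of operators on weighted `L²` -/

section Normality

/-- Two operators given by nonnegative kernels with constant row sums that are adjoint to each
other with respect to the weight `w`. -/
structure IsAdjointPair {V : Type*} (w : V → ℝ) (D : ℝ) (M M' : V → V → ℝ)
    (A A' : (V → ℂ) → V → ℂ) : Prop where
  pos : ∀ u, 0 < w u
  nonneg : ∀ u v, 0 ≤ M u v
  nonneg' : ∀ u v, 0 ≤ M' u v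
  balance : ∀ u v, w u * M u v = w v * M' v u
  hasSum : ∀ f u, HasSum (fun v => (M u v : ℂ) * f v) (A f u)
  hasSum' : ∀ f u, HasSum (fun v => (M' u v : ℂ) * f v) (A' f u)
  rowSum : ∀ u, HasSum (M u) D
  rowSum' : ∀ u, HasSum (M' u) D

namespace IsAdjointPair

variable {V : Type*} {w : V → ℝ} {D : ℝ} {M M' : V → V → ℝ} {A A' : (V → ℂ) → V → ℂ}

theorem symm (h : IsAdjointPair w D M M' A A') : IsAdjointPair w D M' M A' A :=
  ⟨h.pos, h.nonneg', h.nonneg, fun u v => (h.balance v u).symm, h.hasSum', h.hasSum, h.rowSum',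
    h.rowSum⟩

variable (h : IsAdjointPair w D M M' A A')
include h

theorem summable_fst {f : V → ℂ} (hf : Summable fun u => ‖f u‖ ^ 2 * w u) :
    Summable fun p : V × V => w p.1 * M p.1 p.2 * ‖f p.1‖ ^ 2 := by
  have hs : ∀ u, HasSum (fun v => w u * M u v * ‖f u‖ ^ 2) (w u * D * ‖f u‖ ^ 2) := fun u =>
    ((h.rowSum u).mul_left _).mul_right _
  rw [summable_prod_of_nonneg fun p => mul_nonneg (mul_nonneg (h.pos _).le (h.nonneg _ _))
    (sq_nonneg _)]
  refine ⟨fun u => (hs u).summable, ?_⟩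
  refine (hf.mul_left D).congr fun u => ?_
  rw [(hs u).tsum_eq]
  ring

theorem summable_snd {f : V → ℂ} (hf : Summable fun u => ‖f u‖ ^ 2 * w u) :
    Summable fun p : V × V => w p.1 * M p.1 p.2 * ‖f p.2‖ ^ 2 := by
  refine ((Equiv.prodComm V V).summable_iff.mpr (h.symm.summable_fst hf)).congr fun p => ?_
  simp [h.balance p.1 p.2]

/-- Cauchy–Schwarz for the measure `M u`, of total mass `D`, on finite partial sums. -/
theorem norm_sq_le (f : V → ℂ) (u : V) :
    ‖A f u‖ ^ 2 ≤ D * ∑' v, M u v * ‖f v‖ ^ 2 := by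
  -- Summability comes for free, since `hasSum` is required for all functions.
  have hs : Summable fun v => M u v * ‖f v‖ ^ 2 := by
    have := (h.hasSum (fun v => ((‖f v‖ ^ 2 : ℝ) : ℂ)) u).summable
    exact_mod_cast this
  have ht := ((h.hasSum f u).norm).pow 2
  refine le_of_tendsto ht (Filter.Eventually.of_forall fun s => ?_)
  have h1 : ‖∑ v ∈ s, (M u v : ℂ) * f v‖ ≤ ∑ v ∈ s, M u v * ‖f v‖ := by
    refine (norm_sum_le _ _).trans_eq (Finset.sum_congr rfl fun v _ => ?_)
    rw [norm_mul, Complex.norm_real, Real.norm_of_nonneg (h.nonneg _ _)]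
  have h2 : (∑ v ∈ s, M u v * ‖f v‖) ^ 2 ≤ (∑ v ∈ s, M u v) * ∑ v ∈ s, M u v * ‖f v‖ ^ 2 :=
    Finset.sum_sq_le_sum_mul_sum_of_sq_le_mul s (fun v _ => h.nonneg u v)
      (fun v _ => mul_nonneg (h.nonneg u v) (sq_nonneg _)) fun v _ => le_of_eq (by ring)
  have h3 : ∑ v ∈ s, M u v ≤ D := sum_le_hasSum s (fun v _ => h.nonneg u v) (h.rowSum u)
  have h4 : ∑ v ∈ s, M u v * ‖f v‖ ^ 2 ≤ ∑' v, M u v * ‖f v‖ ^ 2 :=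
    hs.sum_le_tsum s fun v _ => mul_nonneg (h.nonneg u v) (sq_nonneg _)
  have h5 : 0 ≤ ∑ v ∈ s, M u v * ‖f v‖ ^ 2 :=
    Finset.sum_nonneg fun v _ => mul_nonneg (h.nonneg u v) (sq_nonneg _)
  have h6 : 0 ≤ D := (h.rowSum u).nonneg fun v => h.nonneg u v
  calc ‖∑ v ∈ s, (M u v : ℂ) * f v‖ ^ 2 ≤ (∑ v ∈ s, M u v * ‖f v‖) ^ 2 := by gcongr
    _ ≤ _ := h2
    _ ≤ _ := by gcongr

theorem summable_apply {f : V → ℂ} (hf : Summable fun u => ‖f u‖ ^ 2 * w u) :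
    Summable fun u => ‖A f u‖ ^ 2 * w u := by
  refine Summable.of_nonneg_of_le (fun u => mul_nonneg (sq_nonneg _) (h.pos u).le) (fun u => ?_)
    ((h.summable_snd hf).prod.mul_left D)
  calc ‖A f u‖ ^ 2 * w u ≤ (D * ∑' v, M u v * ‖f v‖ ^ 2) * w u :=
        mul_le_mul_of_nonneg_right (h.norm_sq_le f u) (h.pos u).le
    _ = D * ∑' v, w u * M u v * ‖f v‖ ^ 2 := by
        simp_rw [mul_assoc (w u), tsum_mul_left]
        ring

/-- Adjointness by Fubini: the double series is dominated through `ab ≤ a² + b²`, and summing it in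
the two orders gives the two pairings. -/
theorem exists_hasSum {f g : V → ℂ} (hf : Summable fun u => ‖f u‖ ^ 2 * w u)
    (hg : Summable fun u => ‖g u‖ ^ 2 * w u) :
    ∃ S : ℂ, HasSum (fun u => (w u : ℂ) * A f u * (starRingEnd ℂ) (g u)) S ∧
      HasSum (fun u => (w u : ℂ) * f u * (starRingEnd ℂ) (A' g u)) S := by
  let P : V × V → ℂ := fun p =>
    (w p.1 : ℂ) * ((M p.1 p.2 : ℂ) * f p.2) * (starRingEnd ℂ) (g p.1)
  have hP : Summable P := by
    refine Summable.of_norm_bounded ((h.summable_fst hg).add (h.summable_snd hf)) fun p => ?_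
    have h1 : ‖P p‖ = w p.1 * M p.1 p.2 * (‖f p.2‖ * ‖g p.1‖) := by
      simp only [P, norm_mul, Complex.norm_real, Real.norm_of_nonneg (h.nonneg _ _),
        Real.norm_of_nonneg (h.pos _).le, RCLike.norm_conj]
      ring
    rw [h1, ← mul_add]
    refine mul_le_mul_of_nonneg_left ?_ (mul_nonneg (h.pos _).le (h.nonneg _ _))
    nlinarith [sq_nonneg (‖f p.2‖ - ‖g p.1‖), sq_nonneg (‖f p.2‖), sq_nonneg (‖g p.1‖)]
  refine ⟨∑' p, P p, ?_, ?_⟩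
  · refine HasSum.prod_fiberwise (f := P) hP.hasSum fun u => ?_
    have h2 : HasSum (fun v => (w u : ℂ) * ((M u v : ℂ) * f v) * (starRingEnd ℂ) (g u))
        ((w u : ℂ) * A f u * (starRingEnd ℂ) (g u)) := ((h.hasSum f u).mul_left _).mul_right _
    exact h2
  · have h2 : HasSum (P ∘ Equiv.prodComm V V) (∑' p, P p) :=
      (Equiv.prodComm V V).hasSum_iff.mpr hP.hasSum
    refine HasSum.prod_fiberwise (f := P ∘ Equiv.prodComm V V) h2 fun v => ?_
    have h3 : HasSum (fun u => (w v : ℂ) * f v * (starRingEnd ℂ) ((M' v u : ℂ) * g u))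
        ((w v : ℂ) * f v * (starRingEnd ℂ) (A' g v)) :=
      (Complex.hasSum_conj'.mpr (h.hasSum' g v)).mul_left _
    have h4 : (fun u => (w v : ℂ) * f v * (starRingEnd ℂ) ((M' v u : ℂ) * g u)) =
        fun u => (P ∘ Equiv.prodComm V V) (v, u) := by
      funext u
      have h5 : (w u : ℂ) * M u v = w v * M' v u := by exact_mod_cast h.balance u v
      simp only [P, Function.comp_apply, Equiv.prodComm_apply, Prod.swap_prod_mk, map_mul,
        Complex.conj_ofReal]
      linear_combination (-(f v) * (starRingEnd ℂ) (g u)) * h5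
    rw [h4] at h3
    exact h3

/-- The usual argument for normal operators. For `g = A'f - c̄f`, commutation gives `Ag = cg`, hence
`⟨A'f, g⟩ = ⟨f, Ag⟩ = c̄⟨f, g⟩` and `‖g‖² = 0`. -/
theorem apply_eq_of_apply_eq {f : V → ℂ} (hf : Summable fun u => ‖f u‖ ^ 2 * w u)
    (hcomm : A (A' f) = A' (A f)) {c : ℂ} (hc : ∀ u, A f u = c * f u) (u : V) :
    A' f u = (starRingEnd ℂ) c * f u := by
  set c' := (starRingEnd ℂ) c with hc'
  let g : V → ℂ := fun u => A' f u - c' * f u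
  have hg : Summable fun u => ‖g u‖ ^ 2 * w u := by
    refine Summable.of_nonneg_of_le (fun u => mul_nonneg (sq_nonneg _) (h.pos u).le) (fun u => ?_)
      (((h.symm.summable_apply hf).mul_left 2).add (hf.mul_left (2 * ‖c'‖ ^ 2)))
    have h1 : ‖g u‖ ≤ ‖A' f u‖ + ‖c'‖ * ‖f u‖ := by
      rw [← norm_mul]
      exact norm_sub_le _ _
    have h2 : ‖g u‖ ^ 2 ≤ 2 * ‖A' f u‖ ^ 2 + 2 * ‖c'‖ ^ 2 * ‖f u‖ ^ 2 := by
      calc ‖g u‖ ^ 2 ≤ (‖A' f u‖ + ‖c'‖ * ‖f u‖) ^ 2 := by gcongr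
        _ ≤ _ := by nlinarith [sq_nonneg (‖A' f u‖ - ‖c'‖ * ‖f u‖)]
    calc ‖g u‖ ^ 2 * w u ≤ (2 * ‖A' f u‖ ^ 2 + 2 * ‖c'‖ ^ 2 * ‖f u‖ ^ 2) * w u :=
          mul_le_mul_of_nonneg_right h2 (h.pos u).le
      _ = _ := by ring
  -- Linearity of `A` and `A'` is not an axiom of the structure; it is read off the kernels.
  have hAg : ∀ u, A g u = c * g u := by
    intro u
    have h1 : A g u = A (A' f) u - c' * A f u := by
      refine (h.hasSum g u).unique ?_
      have e : (fun v => (M u v : ℂ) * g v) =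
          fun v => (M u v : ℂ) * A' f v - c' * ((M u v : ℂ) * f v) := by
        funext v
        simp only [g]
        ring
      rw [e]
      exact (h.hasSum (A' f) u).sub ((h.hasSum f u).mul_left c')
    have h2 : A' (A f) u = c * A' f u := by
      refine (h.hasSum' (A f) u).unique ?_
      have e : (fun v => (M' u v : ℂ) * A f v) = fun v => c * ((M' u v : ℂ) * f v) := by
        funext v
        rw [hc]
        ring
      rw [e]
      exact (h.hasSum' f u).mul_left c
    rw [h1, hcomm, h2, hc]
    ring
  obtain ⟨S, hS1, hS2⟩ := h.symm.exists_hasSum hf hg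
  have h0 : HasSum (fun u => ((‖g u‖ ^ 2 * w u : ℝ) : ℂ)) ((0 : ℝ) : ℂ) := by
    rw [Complex.ofReal_zero, ← sub_self S]
    have e : (fun u => ((‖g u‖ ^ 2 * w u : ℝ) : ℂ)) = fun u =>
        (w u : ℂ) * A' f u * (starRingEnd ℂ) (g u) - w u * f u * (starRingEnd ℂ) (A g u) := by
      funext u
      rw [hAg, map_mul, ← hc', Complex.ofReal_mul, Complex.ofReal_pow, ← Complex.conj_mul']
      generalize hgu : (starRingEnd ℂ) (g u) = b
      simp only [g]
      ring
    rw [e]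
    exact hS1.sub hS2
  rw [Complex.hasSum_ofReal] at h0
  have h1 := (hasSum_zero_iff_of_nonneg fun u => mul_nonneg (sq_nonneg _) (h.pos u).le).mp h0
  have h2 := congrFun h1 u
  have h3 : ‖g u‖ ^ 2 = 0 := (mul_eq_zero.mp h2).resolve_right (h.pos u).ne'
  have h4 : g u = 0 := by simpa using h3
  exact sub_eq_zero.mp h4

end IsAdjointPair

end Normality

/-! ### Explicit formulas on the Weyl chamber and commutation -/

section Chamber

variable {K : Type u} [Field K]

theorem diagClass_swap_fst (a b c : ℤ) : diagClass K ![a, b, c] = diagClass K ![b, a, c] := by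
  rw [← diagClass_comp_perm (Equiv.swap 0 1)]
  congr 1
  ext i
  fin_cases i <;> rfl

theorem diagClass_swap_snd (a b c : ℤ) : diagClass K ![a, b, c] = diagClass K ![a, c, b] := by
  rw [← diagClass_comp_perm (Equiv.swap 1 2)]
  congr 1
  ext i
  fin_cases i <;> rfl

theorem diagClass_eq_vtx {a b c : ℤ} {m n : ℕ} (ha : a = m + c) (hb : b = n + c) :
    diagClass K ![a, b, c] = vtx K m n := by
  rw [vtx_eq_diagClass, ← diagClass_add_const ![(m : ℤ), n, 0] c]
  congr 1
  ext i
  fin_cases i <;> simp [ha, hb]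

theorem antitone_vec {a b c : ℤ} (hab : b ≤ a) (hbc : c ≤ b) : Antitone ![a, b, c] := by
  intro i j hij
  fin_cases i <;> fin_cases j <;> simp at hij ⊢ <;> omega

theorem vtx_cases {p : QVertex K → Prop} (h0 : p (vtx K 0 0)) (hrow : ∀ m, p (vtx K (m + 1) 0))
    (hdiag : ∀ n, p (vtx K (n + 1) (n + 1)))
    (hint : ∀ m n, n + 1 ≤ m → p (vtx K (m + 1) (n + 1))) (u : QVertex K) : p u := by
  obtain ⟨m, n, hmn, rfl⟩ := exists_eq_vtx u
  rcases n with _ | n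
  · rcases m with _ | m
    · exact h0
    · exact hrow m
  · rcases m with _ | m
    · omega
    · rcases (Nat.succ_le_succ_iff.mp hmn).eq_or_lt with rfl | h
      · exact hdiag _
      · exact hint _ _ h

variable [Fintype K]

theorem adjOp_one_vec (f : QVertex K → ℂ) {a b c : ℤ} (hab : b ≤ a) (hbc : c ≤ b) :
    adjOp 1 f (diagClass K ![a, b, c]) = (Fintype.card K : ℂ) ^ 2 * f (diagClass K ![a - 1, b, c]) +
      Fintype.card K * f (diagClass K ![a, b - 1, c]) + f (diagClass K ![a, b, c - 1]) := by
  rw [adjOp_one_diagClass f (antitone_vec hab hbc)]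
  congr 6 <;> ext i <;> fin_cases i <;> simp

theorem adjOp_neg_one_vec (f : QVertex K → ℂ) {a b c : ℤ} (hab : b ≤ a) (hbc : c ≤ b) :
    adjOp (-1) f (diagClass K ![a, b, c]) = f (diagClass K ![a + 1, b, c]) +
      Fintype.card K * f (diagClass K ![a, b + 1, c]) +
      (Fintype.card K : ℂ) ^ 2 * f (diagClass K ![a, b, c + 1]) := by
  rw [adjOp_neg_one_diagClass f (antitone_vec hab hbc)]
  congr 6 <;> ext i <;> fin_cases i <;> simp

/-- Inside the chamber both operators are combinations of translations with constant coefficients.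
On a wall, a step that leaves the chamber is reflected back; the four cases record which walls
contain the point. -/
theorem adjOp_comm (f : QVertex K → ℂ) :
    adjOp 1 (adjOp (-1) f) = adjOp (-1) (adjOp 1 f) := by
  funext u
  obtain ⟨g, rfl⟩ := orbitClass_surjective u
  obtain ⟨d, hd⟩ := exists_orbitClass_eq_diagClass g
  obtain ⟨d', hd', e⟩ := exists_antitone_diagClass_eq (K := K) d
  rw [hd, e]
  have h01 : d' 1 ≤ d' 0 := hd' (by decide)
  have h12 : d' 2 ≤ d' 1 := hd' (by decide)
  have hv : d' = ![d' 0, d' 1, d' 2] := by ext i; fin_cases i <;> rfl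
  rw [hv]
  generalize d' 0 = a at *
  generalize d' 1 = b at *
  generalize d' 2 = c at *
  rcases h01.eq_or_lt with rfl | h01 <;> rcases h12.eq_or_lt with rfl | h12
  · have e1 : diagClass K ![c - 1, c, c] = diagClass K ![c, c, c - 1] := by
      rw [diagClass_swap_fst, diagClass_swap_snd]
    have e2 : diagClass K ![c, c - 1, c] = diagClass K ![c, c, c - 1] := diagClass_swap_snd _ _ _
    have e3 : diagClass K ![c, c + 1, c] = diagClass K ![c + 1, c, c] := diagClass_swap_fst _ _ _
    have e4 : diagClass K ![c, c, c + 1] = diagClass K ![c + 1, c, c] := by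
      rw [diagClass_swap_snd, diagClass_swap_fst]
    have e5 : diagClass K ![c, c + 1, c - 1] = diagClass K ![c + 1, c, c - 1] :=
      diagClass_swap_fst _ _ _
    have e6 : diagClass K ![c + 1, c - 1, c] = diagClass K ![c + 1, c, c - 1] :=
      diagClass_swap_snd _ _ _
    simp (disch := omega) only [adjOp_one_vec, adjOp_neg_one_vec, sub_add_cancel,
      add_sub_cancel_right, e1, e2, e3, e4, e5, e6]
    ring
  · have e1 : ∀ c, diagClass K ![b - 1, b, c] = diagClass K ![b, b - 1, c] :=
      fun c => diagClass_swap_fst _ _ _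
    have e2 : ∀ c, diagClass K ![b, b + 1, c] = diagClass K ![b + 1, b, c] :=
      fun c => diagClass_swap_fst _ _ _
    simp (disch := omega) only [adjOp_one_vec, adjOp_neg_one_vec, sub_add_cancel,
      add_sub_cancel_right, e1, e2]
    ring
  · have e1 : ∀ a, diagClass K ![a, c - 1, c] = diagClass K ![a, c, c - 1] :=
      fun a => diagClass_swap_snd _ _ _
    have e2 : ∀ a, diagClass K ![a, c, c + 1] = diagClass K ![a, c + 1, c] :=
      fun a => diagClass_swap_snd _ _ _
    simp (disch := omega) only [adjOp_one_vec, adjOp_neg_one_vec, sub_add_cancel,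
      add_sub_cancel_right, e1, e2]
    ring
  · simp (disch := omega) only [adjOp_one_vec, adjOp_neg_one_vec, sub_add_cancel,
      add_sub_cancel_right]
    ring

theorem adjOp_one_vtx_zero (f : QVertex K → ℂ) :
    adjOp 1 f (vtx K 0 0) = ((Fintype.card K : ℂ) ^ 2 + Fintype.card K + 1) * f (vtx K 1 1) := by
  rw [vtx_eq_diagClass, Nat.cast_zero, adjOp_one_vec f le_rfl le_rfl,
    diagClass_swap_fst (0 - 1), diagClass_swap_snd 0 (0 - 1) 0,
    diagClass_eq_vtx (m := 1) (n := 1) (by simp) (by simp)]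
  ring

theorem adjOp_one_vtx_row (f : QVertex K → ℂ) (m : ℕ) :
    adjOp 1 f (vtx K (m + 1) 0) = (Fintype.card K : ℂ) ^ 2 * f (vtx K m 0) +
      (Fintype.card K + 1) * f (vtx K (m + 2) 1) := by
  rw [vtx_eq_diagClass, adjOp_one_vec f (by simp; omega) (by simp),
    diagClass_eq_vtx (m := m) (n := 0) (by simp) (by simp),
    diagClass_swap_snd _ (((0 : ℕ) : ℤ) - 1),
    diagClass_eq_vtx (m := m + 2) (n := 1) (by push_cast; ring) (by simp),
    diagClass_eq_vtx (m := m + 2) (n := 1) (by push_cast; ring) (by simp)]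
  ring

theorem adjOp_one_vtx_diag (f : QVertex K → ℂ) (n : ℕ) :
    adjOp 1 f (vtx K (n + 1) (n + 1)) =
      ((Fintype.card K : ℂ) ^ 2 + Fintype.card K) * f (vtx K (n + 1) n) +
      f (vtx K (n + 2) (n + 2)) := by
  rw [vtx_eq_diagClass, adjOp_one_vec f (by simp) (by simp; omega),
    diagClass_swap_fst (((n + 1 : ℕ) : ℤ) - 1),
    diagClass_eq_vtx (m := n + 1) (n := n) (by push_cast; ring) (by push_cast; ring),
    diagClass_eq_vtx (m := n + 2) (n := n + 2) (by push_cast; ring) (by push_cast; ring)]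
  ring

theorem adjOp_one_vtx_interior (f : QVertex K → ℂ) {m n : ℕ} (h : n + 1 ≤ m) :
    adjOp 1 f (vtx K (m + 1) (n + 1)) = (Fintype.card K : ℂ) ^ 2 * f (vtx K m (n + 1)) +
      Fintype.card K * f (vtx K (m + 1) n) + f (vtx K (m + 2) (n + 2)) := by
  rw [vtx_eq_diagClass, adjOp_one_vec f (by simp; omega) (by simp; omega),
    diagClass_eq_vtx (m := m) (n := n + 1) (by push_cast; ring) (by push_cast; ring),
    diagClass_eq_vtx (m := m + 1) (n := n) (by push_cast; ring) (by push_cast; ring),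
    diagClass_eq_vtx (m := m + 2) (n := n + 2) (by push_cast; ring) (by push_cast; ring)]

theorem adjOp_neg_one_vtx_zero (f : QVertex K → ℂ) :
    adjOp (-1) f (vtx K 0 0) =
      ((Fintype.card K : ℂ) ^ 2 + Fintype.card K + 1) * f (vtx K 1 0) := by
  rw [vtx_eq_diagClass, Nat.cast_zero, adjOp_neg_one_vec f le_rfl le_rfl,
    diagClass_swap_snd 0 0 (0 + 1), diagClass_swap_fst 0 (0 + 1),
    diagClass_eq_vtx (m := 1) (n := 0) (by simp) (by simp)]
  ring

theorem adjOp_neg_one_vtx_row (f : QVertex K → ℂ) (m : ℕ) :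
    adjOp (-1) f (vtx K (m + 1) 0) = f (vtx K (m + 2) 0) +
      (Fintype.card K + (Fintype.card K : ℂ) ^ 2) * f (vtx K (m + 1) 1) := by
  rw [vtx_eq_diagClass, adjOp_neg_one_vec f (by simp; omega) (by simp),
    diagClass_swap_snd _ _ ((0 : ℤ) + 1),
    diagClass_eq_vtx (m := m + 2) (n := 0) (by push_cast; ring) (by simp),
    diagClass_eq_vtx (m := m + 1) (n := 1) (by simp) (by simp),
    diagClass_eq_vtx (m := m + 1) (n := 1) (by simp) (by simp)]
  ring

theorem adjOp_neg_one_vtx_diag (f : QVertex K → ℂ) (n : ℕ) :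
    adjOp (-1) f (vtx K (n + 1) (n + 1)) = (1 + Fintype.card K) * f (vtx K (n + 2) (n + 1)) +
      (Fintype.card K : ℂ) ^ 2 * f (vtx K n n) := by
  rw [vtx_eq_diagClass, adjOp_neg_one_vec f (by simp) (by simp; omega),
    diagClass_swap_fst ((n + 1 : ℕ) : ℤ) (((n + 1 : ℕ) : ℤ) + 1),
    diagClass_eq_vtx (m := n + 2) (n := n + 1) (by push_cast; ring) (by push_cast; ring),
    diagClass_eq_vtx (m := n) (n := n) (by push_cast; ring) (by push_cast; ring)]
  ring

theorem adjOp_neg_one_vtx_interior (f : QVertex K → ℂ) {m n : ℕ} (h : n + 1 ≤ m) :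
    adjOp (-1) f (vtx K (m + 1) (n + 1)) = f (vtx K (m + 2) (n + 1)) +
      Fintype.card K * f (vtx K (m + 1) (n + 2)) + (Fintype.card K : ℂ) ^ 2 * f (vtx K m n) := by
  rw [vtx_eq_diagClass, adjOp_neg_one_vec f (by simp; omega) (by simp; omega),
    diagClass_eq_vtx (m := m + 2) (n := n + 1) (by push_cast; ring) (by push_cast; ring),
    diagClass_eq_vtx (m := m + 1) (n := n + 2) (by push_cast; ring) (by push_cast; ring),
    diagClass_eq_vtx (m := m) (n := n) (by push_cast; ring) (by push_cast; ring)]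

theorem isAdjointPair_adjOp : IsAdjointPair (weight (K := K) (X := Vertex K))
    ((Fintype.card K : ℝ) ^ 2 + Fintype.card K + 1) (kernel 1) (kernel (-1)) (adjOp 1)
    (adjOp (-1)) where
  pos := weight_pos
  nonneg := kernel_nonneg 1
  nonneg' := kernel_nonneg (-1)
  balance := weight_mul_kernel (Or.inl rfl)
  hasSum := hasSum_kernel_mul (Or.inl rfl)
  hasSum' := hasSum_kernel_mul (Or.inr rfl)
  rowSum u := by
    have h := hasSum_kernel_mul (Or.inl rfl) (fun _ => 1) u
    obtain ⟨g, rfl⟩ := orbitClass_surjective u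
    rw [adjOp_one_orbitClass] at h
    simp only [mul_one, Finset.sum_const, nsmul_eq_mul] at h
    have h2 : ((Finset.univ : Finset (PlanePoint K)).card : ℂ) =
        (((Fintype.card K : ℝ) ^ 2 + Fintype.card K + 1 : ℝ) : ℂ) := by
      simp [sq, add_assoc]
    rw [h2, Complex.hasSum_ofReal] at h
    exact h
  rowSum' u := by
    have h := hasSum_kernel_mul (Or.inr rfl) (fun _ => 1) u
    obtain ⟨g, rfl⟩ := orbitClass_surjective u
    rw [adjOp_neg_one_orbitClass] at h
    simp only [mul_one, Finset.sum_const, nsmul_eq_mul] at h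
    have h2 : ((Finset.univ : Finset (PlanePoint K)).card : ℂ) =
        (((Fintype.card K : ℝ) ^ 2 + Fintype.card K + 1 : ℝ) : ℂ) := by
      simp [sq, add_assoc]
    rw [h2, Complex.hasSum_ofReal] at h
    exact h

theorem adjOp_neg_one_eq_of_memL2 {f : QVertex K → ℂ} (hf : MemL2 f) {c : ℂ}
    (hc : ∀ u, adjOp 1 f u = c * f u) (u : QVertex K) :
    adjOp (-1) f u = (starRingEnd ℂ) c * f u :=
  isAdjointPair_adjOp.apply_eq_of_apply_eq hf (adjOp_comm f) hc u

theorem adjOp_one_eq_of_memL2 {f : QVertex K → ℂ} (hf : MemL2 f) {c : ℂ}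
    (hc : ∀ u, adjOp (-1) f u = c * f u) (u : QVertex K) :
    adjOp 1 f u = (starRingEnd ℂ) c * f u :=
  isAdjointPair_adjOp.symm.apply_eq_of_apply_eq hf (adjOp_comm f).symm hc u

end Chamber

/-! ### Decaying solutions of a self-reciprocal cubic recurrence -/

section Recurrence

open Filter Topology

theorem eq_zero_of_geometric {c : ℕ → ℂ} {a : ℂ} (hc : ∀ n, c (n + 1) = a * c n) (ha : 1 ≤ ‖a‖)
    (h0 : Tendsto c atTop (𝓝 0)) (n : ℕ) : c n = 0 := by
  have hmono : Monotone fun n => ‖c n‖ := monotone_nat_of_le_succ fun n => by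
    rw [hc, norm_mul]
    exact le_mul_of_one_le_left (norm_nonneg _) ha
  have h1 := hmono.ge_of_tendsto (by simpa using h0.norm) n
  exact norm_le_zero_iff.mp h1

theorem exists_cubic_roots (s t : ℂ) : ∃ α β γ : ℂ, α + β + γ = t ∧ α * β + β * γ + γ * α = s ∧
    α * β * γ = 1 := by
  obtain ⟨α, hα⟩ := IsAlgClosed.exists_root
    (Polynomial.X ^ 3 - Polynomial.C t * Polynomial.X ^ 2 + Polynomial.C s * Polynomial.X - 1 : ℂ[X])
    (by
      have : (Polynomial.X ^ 3 - Polynomial.C t * Polynomial.X ^ 2 +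
        Polynomial.C s * Polynomial.X - 1 : ℂ[X]).degree = 3 := by compute_degree!
      rw [this]
      decide)
  have hα : α ^ 3 - t * α ^ 2 + s * α - 1 = 0 := by simpa [Polynomial.IsRoot] using hα
  have hα0 : α ≠ 0 := by
    rintro rfl
    norm_num at hα
  -- The other two roots have sum `t - α` and product `α⁻¹`.
  obtain ⟨β, hβ⟩ := IsAlgClosed.exists_root
    (Polynomial.X ^ 2 - Polynomial.C (t - α) * Polynomial.X + Polynomial.C α⁻¹ : ℂ[X])
    (by
      have : (Polynomial.X ^ 2 - Polynomial.C (t - α) * Polynomial.X +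
        Polynomial.C α⁻¹ : ℂ[X]).degree = 2 := by compute_degree!
      rw [this]
      decide)
  have hβ : β ^ 2 - (t - α) * β + α⁻¹ = 0 := by simpa [Polynomial.IsRoot] using hβ
  have hαi : α * α⁻¹ = 1 := mul_inv_cancel₀ hα0
  refine ⟨α, β, t - α - β, by ring, ?_, ?_⟩
  · apply mul_left_cancel₀ hα0
    linear_combination -hα - α * hβ + hαi
  · linear_combination -α * hβ + hαi

/-- The cubic is self-reciprocal up to conjugation, so `1/ᾱ` is a root. If `α` and `β` were both
inside the disc, that root would be `γ`; then `|αγ| = 1`, and the product 1 would give `|β| = 1`. -/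
theorem norm_ge_one_of_root {s α β γ : ℂ} (h1 : α + β + γ = (starRingEnd ℂ) s)
    (h2 : α * β + β * γ + γ * α = s) (h3 : α * β * γ = 1) (hα : ‖α‖ < 1) : 1 ≤ ‖β‖ := by
  by_contra! hβ
  have hα0 : α ≠ 0 := by
    rintro rfl
    simp at h3
  have hc0 : (starRingEnd ℂ) α ≠ 0 := (map_ne_zero _).mpr hα0
  have hroot : α ^ 3 - (starRingEnd ℂ) s * α ^ 2 + s * α - 1 = 0 := by
    rw [← h1, ← h2, ← h3]
    ring
  have hconj := congrArg (starRingEnd ℂ) hroot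
  simp only [map_sub, map_add, map_mul, map_pow, map_one, map_zero, Complex.conj_conj] at hconj
  set a := (starRingEnd ℂ) α with ha
  have hprod : (1 - a * α) * (1 - a * β) * (1 - a * γ) = 0 := by
    have : (1 - a * α) * (1 - a * β) * (1 - a * γ) = 1 - a * (α + β + γ) +
        a ^ 2 * (α * β + β * γ + γ * α) - a ^ 3 * (α * β * γ) := by ring
    rw [this, h1, h2, h3]
    linear_combination -hconj
  have hna : ‖a‖ = ‖α‖ := RCLike.norm_conj α
  have hne : ∀ z : ℂ, ‖z‖ < 1 → 1 - a * z ≠ 0 := by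
    intro z hz h
    have h' : a * z = 1 := (sub_eq_zero.mp h).symm
    have := congrArg norm h'
    rw [norm_mul, norm_one, hna] at this
    nlinarith [norm_nonneg α, norm_nonneg z]
  have hγ : a * γ = 1 := by
    rcases mul_eq_zero.mp hprod with h | h
    · exact absurd h (mul_ne_zero (hne α hα) (hne β hβ))
    · exact (sub_eq_zero.mp h).symm
  have n1 := congrArg norm hγ
  have n2 := congrArg norm h3
  rw [norm_mul, norm_one, hna] at n1
  rw [norm_mul, norm_mul, norm_one, mul_right_comm, n1, one_mul] at n2
  linarith

/-- Factor the recurrence as `(E - a)(E - c)(E - r)b = 0` with `E` the shift and `|a|, |c| ≥ 1`. A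
null sequence multiplied at each step by a number of modulus at least 1 is zero, so the two outer
factors can be removed in turn. -/
theorem exists_ratio_of_tendsto_zero {s : ℂ} {b : ℕ → ℂ}
    (hb : ∀ n, b (n + 3) = (starRingEnd ℂ) s * b (n + 2) - s * b (n + 1) + b n)
    (h0 : Tendsto b atTop (𝓝 0)) : ∃ r : ℂ, ∀ n, b (n + 1) = r * b n := by
  obtain ⟨α, β, γ, h1, h2, h3⟩ := exists_cubic_roots s ((starRingEnd ℂ) s)
  -- `r` is the root inside the disc if `α` or `β` is one, and `γ` otherwise.
  obtain ⟨r, a, c, e1, e2, e3, ha, hc⟩ : ∃ r a c : ℂ, r + a + c = (starRingEnd ℂ) s ∧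
      r * a + a * c + c * r = s ∧ r * a * c = 1 ∧ 1 ≤ ‖a‖ ∧ 1 ≤ ‖c‖ := by
    by_cases hα : ‖α‖ < 1
    · exact ⟨α, β, γ, h1, h2, h3, norm_ge_one_of_root h1 h2 h3 hα,
        norm_ge_one_of_root (β := γ) (γ := β) (by linear_combination h1)
          (by linear_combination h2) (by linear_combination h3) hα⟩
    · by_cases hβ : ‖β‖ < 1
      · exact ⟨β, α, γ, by linear_combination h1, by linear_combination h2,
          by linear_combination h3, not_lt.mp hα,
          norm_ge_one_of_root (β := γ) (γ := α) (by linear_combination h1)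
            (by linear_combination h2) (by linear_combination h3) hβ⟩
      · exact ⟨γ, α, β, by linear_combination h1, by linear_combination h2,
          by linear_combination h3, not_lt.mp hα, not_lt.mp hβ⟩
  have t1 : Tendsto (fun n => b (n + 1)) atTop (𝓝 0) := h0.comp (tendsto_add_atTop_nat 1)
  have t2 : Tendsto (fun n => b (n + 2)) atTop (𝓝 0) := h0.comp (tendsto_add_atTop_nat 2)
  have z1 := eq_zero_of_geometric (c := fun n => b (n + 2) - (r + c) * b (n + 1) + r * c * b n)
    (a := a) (fun n => by
      rw [hb n]
      linear_combination (-b (n + 2)) * e1 + b (n + 1) * e2 - b n * e3) ha (by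
      simpa using (t2.sub (t1.const_mul (r + c))).add (h0.const_mul (r * c)))
  have z2 := eq_zero_of_geometric (c := fun n => b (n + 1) - r * b n) (a := c) (fun n => by
      linear_combination z1 n) hc (by simpa using t1.sub (h0.const_mul r))
  exact ⟨r, fun n => sub_eq_zero.mp (z2 n)⟩

end Recurrence

/-! ### An eigenfunction is determined by its value at the origin -/

section Uniqueness

variable {K : Type u} [Field K] [Fintype K]

/-- Induction on `m`: the equation for `A_w⁻` at `v_{m,0}` gives `v_{m+1,0}`, and the one for `A_w⁺`
at `v_{m,n}` gives `v_{m+1,n+1}`; all other terms have first index at most `m`. -/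
theorem eq_of_isEigenfunction {lp lm : ℂ} {f g : QVertex K → ℂ}
    (hf : ∀ u, adjOp 1 f u = lp * f u) (hf' : ∀ u, adjOp (-1) f u = lm * f u)
    (hg : ∀ u, adjOp 1 g u = lp * g u) (hg' : ∀ u, adjOp (-1) g u = lm * g u)
    (h0 : f (vtx K 0 0) = g (vtx K 0 0)) : f = g := by
  have hq : (0 : ℝ) < Fintype.card K := by linarith [one_lt_card K]
  have hq1 : (Fintype.card K : ℂ) + 1 ≠ 0 := by
    exact_mod_cast (by positivity : (Fintype.card K : ℝ) + 1 ≠ 0)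
  have hq2 : (Fintype.card K : ℂ) ^ 2 + Fintype.card K + 1 ≠ 0 := by
    exact_mod_cast (by positivity : (Fintype.card K : ℝ) ^ 2 + Fintype.card K + 1 ≠ 0)
  have key : ∀ m, ∀ m' ≤ m, ∀ n ≤ m', f (vtx K m' n) = g (vtx K m' n) := by
    intro m
    induction m with
    | zero =>
      intro m' hm' n hn
      obtain rfl : m' = 0 := by omega
      obtain rfl : n = 0 := by omega
      exact h0
    | succ m ih =>
      intro m' hm' n hn
      rcases hm'.lt_or_eq with hlt | rfl
      · exact ih m' (by omega) n hn
      rcases n with _ | n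
      · rcases m with _ | m
        · apply mul_left_cancel₀ hq2
          have e1 := hf' (vtx K 0 0)
          have e2 := hg' (vtx K 0 0)
          rw [adjOp_neg_one_vtx_zero] at e1 e2
          linear_combination e1 - e2 + lm * h0
        · have e1 := hf' (vtx K (m + 1) 0)
          have e2 := hg' (vtx K (m + 1) 0)
          rw [adjOp_neg_one_vtx_row] at e1 e2
          linear_combination e1 - e2 + lm * ih (m + 1) le_rfl 0 (by omega) -
            (Fintype.card K + (Fintype.card K : ℂ) ^ 2) * ih (m + 1) le_rfl 1 (by omega)
      · rcases n with _ | n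
        · rcases m with _ | m
          · apply mul_left_cancel₀ hq2
            have e1 := hf (vtx K 0 0)
            have e2 := hg (vtx K 0 0)
            rw [adjOp_one_vtx_zero] at e1 e2
            linear_combination e1 - e2 + lp * h0
          · apply mul_left_cancel₀ hq1
            have e1 := hf (vtx K (m + 1) 0)
            have e2 := hg (vtx K (m + 1) 0)
            rw [adjOp_one_vtx_row] at e1 e2
            linear_combination e1 - e2 + lp * ih (m + 1) le_rfl 0 (by omega) -
              (Fintype.card K : ℂ) ^ 2 * ih m (by omega) 0 (by omega)
        · obtain ⟨m, rfl⟩ : ∃ k, m = k + 1 := ⟨m - 1, by omega⟩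
          have e1 := hf (vtx K (m + 1) (n + 1))
          have e2 := hg (vtx K (m + 1) (n + 1))
          rcases (show n ≤ m by omega).eq_or_lt with rfl | hnm
          · rw [adjOp_one_vtx_diag] at e1 e2
            linear_combination e1 - e2 + lp * ih (n + 1) le_rfl (n + 1) (by omega) -
              ((Fintype.card K : ℂ) ^ 2 + Fintype.card K) * ih (n + 1) le_rfl n (by omega)
          · rw [adjOp_one_vtx_interior _ hnm] at e1 e2
            linear_combination e1 - e2 + lp * ih (m + 1) le_rfl (n + 1) (by omega) -
              (Fintype.card K : ℂ) ^ 2 * ih m (by omega) (n + 1) (by omega) -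
              Fintype.card K * ih (m + 1) le_rfl n (by omega)
  funext u
  obtain ⟨m, n, hmn, rfl⟩ := exists_eq_vtx u
  exact key m m le_rfl n hmn

end Uniqueness

/-! ### Decay of the weights and the total weight -/

section WeightBounds

variable {K : Type u} [Field K]

theorem single_vtx [DecidableEq (QVertex K)] {m n m' n' : ℕ} (h : n ≤ m) (h' : n' ≤ m') :
    (Pi.single (vtx K m n) 1 : QVertex K → ℂ) (vtx K m' n') =
      if m = m' ∧ n = n' then 1 else 0 := by
  by_cases e : m = m' ∧ n = n'
  · obtain ⟨rfl, rfl⟩ := e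
    simp
  · rw [if_neg e, Pi.single_eq_of_ne]
    intro e'
    exact e (vtx_injective h h' e'.symm)

variable [Fintype K]

theorem kernel_le (i : ZMod 3) (hi : i = 1 ∨ i = -1) (u v : QVertex K) :
    kernel i u v ≤ (Fintype.card K : ℝ) ^ 2 + Fintype.card K + 1 := by
  rcases hi with rfl | rfl
  · exact le_hasSum (isAdjointPair_adjOp.rowSum u) v fun _ _ => kernel_nonneg _ _ _
  · exact le_hasSum (isAdjointPair_adjOp.rowSum' u) v fun _ _ => kernel_nonneg _ _ _

theorem kernel_one_left (m n : ℕ) (h : n ≤ m) :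
    kernel 1 (vtx K (m + 1) n) (vtx K m n) = (Fintype.card K : ℝ) ^ 2 := by
  classical
  have e := adjOp_single (Or.inl rfl) (vtx K (m + 1) n) (vtx K m n)
  suffices hs : adjOp 1 (Pi.single (vtx K m n) 1) (vtx K (m + 1) n) = (Fintype.card K : ℂ) ^ 2 by
    rw [hs] at e
    exact_mod_cast e.symm
  rcases n with _ | n
  · rw [adjOp_one_vtx_row, single_vtx (by omega) (by omega), single_vtx (by omega) (by omega)]
    simp
  · rw [adjOp_one_vtx_interior _ h, single_vtx (by omega) (by omega),
      single_vtx (by omega) (by omega), single_vtx (by omega) (by omega)]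
    simp

theorem kernel_neg_one_right (m n : ℕ) (h : n < m) :
    kernel (-1) (vtx K m n) (vtx K (m + 1) n) = 1 := by
  classical
  obtain ⟨m, rfl⟩ : ∃ k, m = k + 1 := ⟨m - 1, by omega⟩
  have e := adjOp_single (Or.inr rfl) (vtx K (m + 1) n) (vtx K (m + 1 + 1) n)
  suffices hs : adjOp (-1) (Pi.single (vtx K (m + 1 + 1) n) 1) (vtx K (m + 1) n) = 1 by
    rw [hs] at e
    exact_mod_cast e.symm
  rcases n with _ | n
  · rw [adjOp_neg_one_vtx_row, single_vtx (by omega) (by omega), single_vtx (by omega) (by omega)]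
    simp
  · rw [adjOp_neg_one_vtx_interior _ (by omega), single_vtx (by omega) (by omega),
      single_vtx (by omega) (by omega), single_vtx (by omega) (by omega)]
    simp

theorem kernel_one_diag (n : ℕ) (hn : 0 < n) :
    kernel 1 (vtx K n n) (vtx K (n + 1) (n + 1)) = 1 := by
  classical
  obtain ⟨n, rfl⟩ : ∃ k, n = k + 1 := ⟨n - 1, by omega⟩
  have e := adjOp_single (Or.inl rfl) (vtx K (n + 1) (n + 1)) (vtx K (n + 1 + 1) (n + 1 + 1))
  rw [adjOp_one_vtx_diag, single_vtx (by omega) (by omega), single_vtx (by omega) (by omega)] at e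
  simp at e
  exact_mod_cast e.symm

theorem kernel_neg_one_diag (n : ℕ) :
    kernel (-1) (vtx K (n + 1) (n + 1)) (vtx K n n) = (Fintype.card K : ℝ) ^ 2 := by
  classical
  have e := adjOp_single (Or.inr rfl) (vtx K (n + 1) (n + 1)) (vtx K n n)
  rw [adjOp_neg_one_vtx_diag, single_vtx (by omega) (by omega), single_vtx (by omega) (by omega)]
    at e
  simp at e
  exact_mod_cast e.symm

/-- Detailed balance along the edge from `v_{m+1,0}` to `v_{m+2,0}`, with kernel values 1 and `q²`.
The origin is excluded because all of its neighbours in one colour direction lie over a single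
vertex. -/
theorem weight_row (m : ℕ) :
    weight (vtx K 1 0) = weight (vtx K (m + 1) 0) * ((Fintype.card K : ℝ) ^ 2) ^ m := by
  induction m with
  | zero => simp
  | succ m ih =>
    have h := weight_mul_kernel (Or.inl rfl) (vtx K (m + 1 + 1) 0) (vtx K (m + 1) 0)
    rw [kernel_one_left _ _ (by omega), kernel_neg_one_right _ _ (by omega), mul_one] at h
    rw [ih, ← h]
    ring

theorem weight_diag_le (n : ℕ) :
    weight (vtx K n n) * ((Fintype.card K : ℝ) ^ 2) ^ n ≤
      ((Fintype.card K : ℝ) ^ 2 + Fintype.card K + 1) * weight (vtx K 0 0) := by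
  have hq : (1 : ℝ) < Fintype.card K := one_lt_card K
  induction n with
  | zero =>
    have := weight_pos (vtx K 0 0)
    simp only [pow_zero, mul_one]
    nlinarith [sq_nonneg (Fintype.card K : ℝ)]
  | succ n ih =>
    have h := weight_mul_kernel (Or.inl rfl) (vtx K n n) (vtx K (n + 1) (n + 1))
    rw [kernel_neg_one_diag] at h
    rw [pow_succ', ← mul_assoc, ← h]
    rcases n.eq_zero_or_pos with rfl | hn
    · have h2 := kernel_le 1 (Or.inl rfl) (vtx K 0 0) (vtx K (0 + 1) (0 + 1))
      rw [pow_zero, mul_one, mul_comm]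
      exact mul_le_mul_of_nonneg_right h2 (weight_pos _).le
    · rw [kernel_one_diag n hn, mul_one]
      exact ih

/-- Walk along the diagonal to `v_{n,n}`, then along increasing `m`. Each step divides the weight by
`q²`, except for a factor of at most `q²+q+1` on leaving the origin and another on leaving the
diagonal. -/
theorem weight_le (m n : ℕ) (h : n ≤ m) :
    weight (vtx K m n) * ((Fintype.card K : ℝ) ^ 2) ^ m ≤
      ((Fintype.card K : ℝ) ^ 2 + Fintype.card K + 1) ^ 2 * weight (vtx K 0 0) := by
  have hq : (1 : ℝ) < Fintype.card K := one_lt_card K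
  induction m, h using Nat.le_induction with
  | base =>
    refine (weight_diag_le n).trans ?_
    have := weight_pos (vtx K 0 0)
    have hD : 1 ≤ (Fintype.card K : ℝ) ^ 2 + Fintype.card K + 1 := by nlinarith
    rw [sq ((Fintype.card K : ℝ) ^ 2 + Fintype.card K + 1), mul_assoc]
    exact le_mul_of_one_le_left (by positivity) hD
  | succ m h ih =>
    have h1 := weight_mul_kernel (Or.inl rfl) (vtx K (m + 1) n) (vtx K m n)
    rw [kernel_one_left _ _ h] at h1
    rw [pow_succ', ← mul_assoc, h1]
    rcases h.eq_or_lt with rfl | hlt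
    · have h2 := kernel_le (-1) (Or.inr rfl) (vtx K n n) (vtx K (n + 1) n)
      have h3 := weight_diag_le (K := K) n
      have h4 : 0 ≤ weight (vtx K n n) * ((Fintype.card K : ℝ) ^ 2) ^ n :=
        mul_nonneg (weight_pos _).le (by positivity)
      calc weight (vtx K n n) * kernel (-1) (vtx K n n) (vtx K (n + 1) n) *
            ((Fintype.card K : ℝ) ^ 2) ^ n =
          kernel (-1) (vtx K n n) (vtx K (n + 1) n) *
            (weight (vtx K n n) * ((Fintype.card K : ℝ) ^ 2) ^ n) := by ring
        _ ≤ ((Fintype.card K : ℝ) ^ 2 + Fintype.card K + 1) *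
            (((Fintype.card K : ℝ) ^ 2 + Fintype.card K + 1) * weight (vtx K 0 0)) :=
          mul_le_mul h2 h3 h4 (by positivity)
        _ = _ := by ring
    · rw [kernel_neg_one_right _ _ hlt, mul_one]
      exact ih

theorem summable_weight : Summable (weight (K := K) (X := Vertex K)) := by
  have hq : (1 : ℝ) < Fintype.card K := one_lt_card K
  let T := {p : ℕ × ℕ // p.2 ≤ p.1}
  let φ : T → QVertex K := fun p => vtx K p.1.1 p.1.2
  have hφ : Function.Bijective φ := by
    constructor
    · rintro ⟨⟨m, n⟩, h⟩ ⟨⟨m', n'⟩, h'⟩ e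
      obtain ⟨rfl, rfl⟩ := vtx_injective h h' e
      rfl
    · intro u
      obtain ⟨m, n, h, rfl⟩ := exists_eq_vtx u
      exact ⟨⟨(m, n), h⟩, rfl⟩
  rw [← (Equiv.ofBijective φ hφ).summable_iff]
  set C := ((Fintype.card K : ℝ) ^ 2 + Fintype.card K + 1) ^ 2 * weight (vtx K 0 0)
  have hC : 0 ≤ C := mul_nonneg (by positivity) (weight_pos _).le
  have hr0 : (0 : ℝ) ≤ (Fintype.card K : ℝ)⁻¹ := by positivity
  have hgeom := summable_geometric_of_lt_one hr0 (inv_lt_one_of_one_lt₀ hq)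
  have hsum : Summable fun p : ℕ × ℕ =>
      (Fintype.card K : ℝ)⁻¹ ^ p.1 * (Fintype.card K : ℝ)⁻¹ ^ p.2 :=
    hgeom.mul_of_nonneg hgeom (fun _ => by positivity) fun _ => by positivity
  refine Summable.of_nonneg_of_le (fun p => (weight_pos _).le) (fun p => ?_)
    ((hsum.mul_left C).comp_injective (i := fun p : T => p.1) Subtype.val_injective)
  obtain ⟨⟨m, n⟩, h⟩ := p
  have h1 := weight_le (K := K) m n h
  change weight (vtx K m n) ≤ C * ((Fintype.card K : ℝ)⁻¹ ^ m * (Fintype.card K : ℝ)⁻¹ ^ n)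
  have hpos : (0 : ℝ) < ((Fintype.card K : ℝ) ^ 2) ^ m := by positivity
  calc weight (vtx K m n) ≤ C / ((Fintype.card K : ℝ) ^ 2) ^ m := by rwa [le_div_iff₀ hpos]
    _ = C * ((Fintype.card K : ℝ)⁻¹ ^ m * (Fintype.card K : ℝ)⁻¹ ^ m) := by
        rw [← pow_mul, two_mul, pow_add, inv_pow, ← mul_inv]
        rfl
    _ ≤ _ := by
        -- Half of the decay in `m` is spent on decay in `n`, possible as `n ≤ m`.
        have : (Fintype.card K : ℝ)⁻¹ ^ m ≤ (Fintype.card K : ℝ)⁻¹ ^ n :=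
          pow_le_pow_of_le_one hr0 (inv_le_one_of_one_le₀ hq.le) h
        gcongr

theorem memL2_of_bounded {f : QVertex K → ℂ} {C : ℝ} (hf : ∀ u, ‖f u‖ ≤ C) : MemL2 f := by
  refine Summable.of_nonneg_of_le (fun u => mul_nonneg (sq_nonneg _) (weight_pos u).le)
    (fun u => ?_) (summable_weight.mul_left (C ^ 2))
  have := hf u
  have := (weight_pos u).le
  gcongr

open Filter Topology in
theorem tendsto_row_of_memL2 {f : QVertex K → ℂ} (hf : MemL2 f) :
    Tendsto (fun m : ℕ => f (vtx K m 0) / (Fintype.card K : ℂ) ^ m) atTop (𝓝 0) := by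
  have hq : (1 : ℝ) < Fintype.card K := one_lt_card K
  -- The exact formula for the weights starts at `v_{1,0}`.
  rw [← tendsto_add_atTop_iff_nat 1]
  have hinj : Function.Injective fun m : ℕ => vtx K (m + 1) 0 := by
    intro m m' e
    have := (vtx_injective (Nat.zero_le _) (Nat.zero_le _) e).1
    omega
  have h1 := (hf.comp_injective hinj).tendsto_atTop_zero
  have h2 : Tendsto (fun m : ℕ => ‖f (vtx K (m + 1) 0) / (Fintype.card K : ℂ) ^ (m + 1)‖ ^ 2)
      atTop (𝓝 0) := by
    have h3 := h1.const_mul (((Fintype.card K : ℝ) ^ 2 * weight (vtx K 1 0))⁻¹)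
    rw [mul_zero] at h3
    refine h3.congr fun m => ?_
    have hw := weight_pos (vtx K (m + 1) 0)
    simp only [Function.comp_apply]
    rw [weight_row m, norm_div, norm_pow, Complex.norm_natCast]
    have hq0 : (Fintype.card K : ℝ) ≠ 0 := by positivity
    field_simp
    ring
  rw [tendsto_zero_iff_norm_tendsto_zero]
  have h3 := h2.sqrt
  rw [Real.sqrt_zero] at h3
  exact h3.congr fun m => Real.sqrt_sq (norm_nonneg _)

end WeightBounds

/-! ### The trivial eigenfunctions and the eigenvalues of `L²` eigenfunctions -/

section Eigenfunctions

variable {K : Type u} [Field K]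

variable (K) in
/-- The function `v_{m,n} ↦ ω ^ (m + n)`. -/
def trivialFunction (ω : ℂ) (u : QVertex K) : ℂ :=
  ω ^ ((exists_eq_vtx u).choose + (exists_eq_vtx u).choose_spec.choose)

theorem trivialFunction_vtx (ω : ℂ) {m n : ℕ} (h : n ≤ m) :
    trivialFunction K ω (vtx K m n) = ω ^ (m + n) := by
  obtain ⟨h1, h2⟩ := (exists_eq_vtx (vtx K m n)).choose_spec.choose_spec
  obtain ⟨e1, e2⟩ := vtx_injective h h1 h2
  exact (congrArg₂ (fun a b => ω ^ (a + b)) e1 e2).symm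

theorem norm_eq_one_of_cube {ω : ℂ} (hω : ω ^ 3 = 1) : ‖ω‖ = 1 :=
  Complex.norm_eq_one_of_pow_eq_one hω (by norm_num)

theorem inv_of_cube {ω : ℂ} (hω : ω ^ 3 = 1) : ω⁻¹ = ω ^ 2 := by
  refine inv_eq_of_mul_eq_one_right ?_
  rw [← hω]
  ring

theorem conj_of_cube {ω : ℂ} (hω : ω ^ 3 = 1) : (starRingEnd ℂ) ω = ω⁻¹ :=
  (Complex.inv_eq_conj (norm_eq_one_of_cube hω)).symm

variable [Fintype K]

theorem memL2_of_vtx_eq {f : QVertex K → ℂ} {ω c : ℂ} (hω : ω ^ 3 = 1)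
    (hf : ∀ m n : ℕ, n ≤ m → f (vtx K m n) = c * ω ^ (m + n)) : MemL2 f := by
  refine memL2_of_bounded (C := ‖c‖) fun u => ?_
  obtain ⟨m, n, h, rfl⟩ := exists_eq_vtx u
  rw [hf m n h, norm_mul, norm_pow, norm_eq_one_of_cube hω, one_pow, mul_one]

theorem memL2_trivialFunction {ω : ℂ} (hω : ω ^ 3 = 1) : MemL2 (trivialFunction K ω) :=
  memL2_of_vtx_eq (c := 1) hω fun m n h => by rw [trivialFunction_vtx ω h, one_mul]

/-- The colour of `v_{m,n}` is `-(m+n)`, so the function depends only on the colour, and raising the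
colour by 1 multiplies it by `ω⁻¹`. Writing `ω⁻¹` as `ω²` makes every equation polynomial. -/
theorem adjOp_one_trivialFunction {ω : ℂ} (hω : ω ^ 3 = 1) (u : QVertex K) :
    adjOp 1 (trivialFunction K ω) u =
      ((Fintype.card K : ℂ) ^ 2 + Fintype.card K + 1) * ω⁻¹ * trivialFunction K ω u := by
  rw [inv_of_cube hω]
  induction u using vtx_cases with
  | h0 =>
    rw [adjOp_one_vtx_zero, trivialFunction_vtx _ (by omega), trivialFunction_vtx _ (by omega)]
    ring
  | hrow m =>
    rw [adjOp_one_vtx_row, trivialFunction_vtx _ (by omega), trivialFunction_vtx _ (by omega),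
      trivialFunction_vtx _ (by omega)]
    linear_combination (-(Fintype.card K : ℂ) ^ 2 * ω ^ m) * hω
  | hdiag n =>
    rw [adjOp_one_vtx_diag, trivialFunction_vtx _ (by omega), trivialFunction_vtx _ (by omega),
      trivialFunction_vtx _ (by omega)]
    linear_combination
      (-((Fintype.card K : ℂ) ^ 2 + Fintype.card K) * ω ^ (2 * n + 1)) * hω
  | hint m n h =>
    rw [adjOp_one_vtx_interior _ h, trivialFunction_vtx _ (by omega),
      trivialFunction_vtx _ (by omega), trivialFunction_vtx _ (by omega),
      trivialFunction_vtx _ (by omega)]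
    linear_combination
      (-((Fintype.card K : ℂ) ^ 2 + Fintype.card K) * ω ^ (m + n + 1)) * hω

theorem adjOp_neg_one_trivialFunction {ω : ℂ} (hω : ω ^ 3 = 1) (u : QVertex K) :
    adjOp (-1) (trivialFunction K ω) u =
      ((Fintype.card K : ℂ) ^ 2 + Fintype.card K + 1) * ω * trivialFunction K ω u := by
  induction u using vtx_cases with
  | h0 =>
    rw [adjOp_neg_one_vtx_zero, trivialFunction_vtx _ (by omega),
      trivialFunction_vtx _ (by omega)]
    ring
  | hrow m =>
    rw [adjOp_neg_one_vtx_row, trivialFunction_vtx _ (by omega), trivialFunction_vtx _ (by omega),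
      trivialFunction_vtx _ (by omega)]
    ring
  | hdiag n =>
    rw [adjOp_neg_one_vtx_diag, trivialFunction_vtx _ (by omega), trivialFunction_vtx _ (by omega),
      trivialFunction_vtx _ (by omega)]
    linear_combination (-(Fintype.card K : ℂ) ^ 2 * ω ^ (2 * n)) * hω
  | hint m n h =>
    rw [adjOp_neg_one_vtx_interior _ h, trivialFunction_vtx _ (by omega),
      trivialFunction_vtx _ (by omega), trivialFunction_vtx _ (by omega),
      trivialFunction_vtx _ (by omega)]
    linear_combination (-(Fintype.card K : ℂ) ^ 2 * ω ^ (m + n)) * hω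

theorem isEigenfunction_trivialFunction {ω : ℂ} (hω : ω ^ 3 = 1) :
    IsEigenfunction (((Fintype.card K : ℂ) ^ 2 + Fintype.card K + 1) * ω⁻¹)
      (((Fintype.card K : ℂ) ^ 2 + Fintype.card K + 1) * ω) (trivialFunction K ω) := by
  refine ⟨fun h => ?_, adjOp_one_trivialFunction hω, adjOp_neg_one_trivialFunction hω⟩
  have h0 := congrFun h (vtx K 0 0)
  rw [trivialFunction_vtx ω le_rfl] at h0
  simp at h0

theorem apply_vtx_zero_ne_zero {lp lm : ℂ} {f : QVertex K → ℂ} (hf : IsEigenfunction lp lm f) :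
    f (vtx K 0 0) ≠ 0 := by
  intro h0
  have hz : ∀ i u, adjOp i (0 : QVertex K → ℂ) u = 0 := by
    intro i u
    simp [adjOp]
  exact hf.1 (eq_of_isEigenfunction hf.2.1 hf.2.2 (fun u => by simp [hz]) (fun u => by simp [hz])
    (by rw [h0, Pi.zero_apply]))

/-- Decay along the wall makes `f` geometric there; the equations at the corner then fix the ratio.
-/
theorem eigenvalue_of_memL2 {lp lm : ℂ} {f : QVertex K → ℂ} (hf : IsEigenfunction lp lm f)
    (hL : MemL2 f) (hconj : (starRingEnd ℂ) lp = lm) :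
    ∃ ω : ℂ, ω ^ 3 = 1 ∧ lp = ((Fintype.card K : ℂ) ^ 2 + Fintype.card K + 1) * ω⁻¹ ∧
      lm = ((Fintype.card K : ℂ) ^ 2 + Fintype.card K + 1) * ω := by
  have ha0 := apply_vtx_zero_ne_zero hf
  have hlim := tendsto_row_of_memL2 hL
  have hq0 : (0 : ℝ) < Fintype.card K := by linarith [one_lt_card K]
  have hqc := Complex.conj_natCast (Fintype.card K)
  have hq : (Fintype.card K : ℂ) ≠ 0 := by exact_mod_cast hq0.ne'
  have hq1 : (Fintype.card K : ℂ) + 1 ≠ 0 := by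
    exact_mod_cast (by positivity : (Fintype.card K : ℝ) + 1 ≠ 0)
  have hq2 : (Fintype.card K : ℂ) ^ 2 + Fintype.card K + 1 ≠ 0 := by
    exact_mod_cast (by positivity : (Fintype.card K : ℝ) ^ 2 + Fintype.card K + 1 ≠ 0)
  have p0 := hf.2.1 (vtx K 0 0)
  have m0 := hf.2.2 (vtx K 0 0)
  have m1 := hf.2.2 (vtx K 1 0)
  have pr : ∀ n, _ := fun n => hf.2.1 (vtx K (n + 1) 0)
  have mr : ∀ n, _ := fun n => hf.2.2 (vtx K (n + 1) 0)
  simp only [adjOp_one_vtx_zero, adjOp_neg_one_vtx_zero, adjOp_one_vtx_row,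
    adjOp_neg_one_vtx_row] at p0 m0 pr mr
  rw [show vtx K 1 0 = vtx K (0 + 1) 0 from rfl, adjOp_neg_one_vtx_row] at m1
  have hnorm : ‖(Fintype.card K : ℂ)‖ = Fintype.card K := Complex.norm_natCast _
  generalize (Fintype.card K : ℂ) = q at *
  set b : ℕ → ℂ := fun n => f (vtx K n 0) / q ^ n with hb
  have hfb : ∀ n, f (vtx K n 0) = q ^ n * b n := fun n =>
    (mul_div_cancel₀ _ (pow_ne_zero n hq)).symm
  -- Both equations contain the value at `v_{n+2,1}`, with coefficients `q + q²` and `q + 1`;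
  -- subtracting `q` times the second eliminates it.
  have hrec : ∀ n, b (n + 3) =
      (starRingEnd ℂ) (lp / q) * b (n + 2) - lp / q * b (n + 1) + b n := by
    intro n
    have e1 := mr (n + 1)
    have e2 := pr n
    rw [map_div₀, hconj, hqc]
    simp only [show n + 1 + 2 = n + 3 from rfl, show n + 1 + 1 = n + 2 from rfl, hfb] at e1 e2
    have e3 : q ^ (n + 3) * b (n + 3) = lm * (q ^ (n + 2) * b (n + 2)) -
        q * (lp * (q ^ (n + 1) * b (n + 1)) - q ^ 2 * (q ^ n * b n)) := by
      linear_combination e1 - q * e2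
    apply mul_left_cancel₀ (pow_ne_zero (n + 3) hq)
    rw [e3]
    field_simp
    ring
  obtain ⟨r, hr⟩ := exists_ratio_of_tendsto_zero hrec hlim
  have hb0 : b 0 = f (vtx K 0 0) := by simp [hb]
  have hb1 : f (vtx K 1 0) = q * r * f (vtx K 0 0) := by
    rw [hfb 1, hr 0, hb0]
    ring
  have hb2 : f (vtx K 2 0) = q ^ 2 * r ^ 2 * f (vtx K 0 0) := by
    rw [hfb 2, hr 1, hr 0, hb0]
    ring
  rw [show 0 + 2 = 2 from rfl, show 0 + 1 = 1 from rfl] at m1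
  rw [hb1] at m0 m1
  rw [hb2] at m1
  have hlm : lm = (q ^ 2 + q + 1) * (q * r) := by
    apply mul_right_cancel₀ ha0
    linear_combination -m0
  have hlp : lp = (q ^ 2 + q + 1) * (q * (starRingEnd ℂ) r) := by
    rw [← Complex.conj_conj lp, hconj, hlm]
    simp [hqc]
  have h11 : f (vtx K 1 1) = q * (starRingEnd ℂ) r * f (vtx K 0 0) := by
    apply mul_left_cancel₀ hq2
    rw [p0, hlp]
    ring
  -- The equation for `A_w⁻` at `v_{1,0}`, after substituting the values at `v_{1,0}`, `v_{2,0}` and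
  -- `v_{1,1}` and cancelling `q²(q+1)f(v_{0,0})`.
  have hrr : q * r ^ 2 = (starRingEnd ℂ) r := by
    rw [h11, hlm] at m1
    apply mul_left_cancel₀ (mul_ne_zero (mul_ne_zero (mul_ne_zero hq hq) hq1) ha0)
    linear_combination -m1
  have hr0 : r ≠ 0 := by
    rintro rfl
    have h1 : ∀ n, b (n + 1) = 0 := fun n => by rw [hr, zero_mul]
    have h2 := hrec 0
    rw [h1, h1, h1, mul_zero, mul_zero, sub_zero, zero_add, hb0] at h2
    exact ha0 h2.symm
  have hn : ‖q * r‖ = 1 := by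
    have := congrArg norm hrr
    rw [norm_mul, norm_pow, RCLike.norm_conj] at this
    rw [norm_mul]
    apply mul_right_cancel₀ (norm_ne_zero_iff.mpr hr0)
    linear_combination this
  have hinv : (q * r)⁻¹ = q * (starRingEnd ℂ) r := by
    rw [Complex.inv_eq_conj hn, map_mul, hqc]
  refine ⟨q * r, ?_, by rw [hlp, hinv], hlm⟩
  -- With `ω = qr`, the relation `q r² = r̄` says `ω² = ω̄`, and `|ω| = 1` turns this into `ω³ = 1`.
  have h1 : q * r * (q * (starRingEnd ℂ) r) = 1 := by
    rw [← hinv, mul_inv_cancel₀ (mul_ne_zero hq hr0)]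
  linear_combination h1 + q ^ 2 * r * hrr

theorem eq_trivialFunction_of_isEigenfunction {ω : ℂ} (hω : ω ^ 3 = 1) {f : QVertex K → ℂ}
    (hf : IsEigenfunction (((Fintype.card K : ℂ) ^ 2 + Fintype.card K + 1) * ω⁻¹)
      (((Fintype.card K : ℂ) ^ 2 + Fintype.card K + 1) * ω) f) {m n : ℕ} (h : n ≤ m) :
    f (vtx K m n) = f (vtx K 0 0) * ω ^ (m + n) := by
  have hmul : ∀ (c : ℂ) {i : ZMod 3} (_ : i = 1 ∨ i = -1) (g : QVertex K → ℂ) (u : QVertex K),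
      adjOp i (fun u => c * g u) u = c * adjOp i g u := by
    intro c i hi g u
    refine (hasSum_kernel_mul hi _ u).unique ?_
    have e : (fun v => (kernel i u v : ℂ) * (c * g v)) =
        fun v => c * ((kernel i u v : ℂ) * g v) := by
      funext v
      ring
    rw [e]
    exact (hasSum_kernel_mul hi g u).mul_left c
  have e := eq_of_isEigenfunction (g := fun u => f (vtx K 0 0) * trivialFunction K ω u)
    hf.2.1 hf.2.2
    (fun u => by rw [hmul _ (Or.inl rfl), adjOp_one_trivialFunction hω]; ring)
    (fun u => by rw [hmul _ (Or.inr rfl), adjOp_neg_one_trivialFunction hω]; ring)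
    (by rw [trivialFunction_vtx ω le_rfl]; simp)
  have := congrFun e (vtx K m n)
  rwa [trivialFunction_vtx ω h] at this

theorem cube_eq_one_iff {ω : ℂ} : ω ^ 3 = 1 ↔ ω = 1 ∨
    ω = Complex.exp (2 * Real.pi * Complex.I / 3) ∨
    ω = Complex.exp (4 * Real.pi * Complex.I / 3) := by
  have hp : IsPrimitiveRoot (Complex.exp (2 * Real.pi * Complex.I / 3)) 3 := by
    exact_mod_cast Complex.isPrimitiveRoot_exp 3 (by norm_num)
  have h2 : Complex.exp (4 * Real.pi * Complex.I / 3) =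
      Complex.exp (2 * Real.pi * Complex.I / 3) ^ 2 := by
    rw [← Complex.exp_nat_mul]
    congr 1
    push_cast
    ring
  rw [h2]
  constructor
  · intro h
    obtain ⟨i, hi, rfl⟩ := hp.eq_pow_of_pow_eq_one h
    interval_cases i <;> simp
  · rintro (rfl | rfl | rfl)
    · norm_num
    · exact hp.pow_eq_one
    · rw [pow_right_comm, hp.pow_eq_one, one_pow]

theorem mem_cube_roots_iff {l Q : ℂ} : l ∈ ({Q,
      Q * Complex.exp (2 * Real.pi * Complex.I / 3),
      Q * Complex.exp (4 * Real.pi * Complex.I / 3)} : Set ℂ) ↔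
    ∃ ω : ℂ, ω ^ 3 = 1 ∧ l = Q * ω := by
  simp only [cube_eq_one_iff, Set.mem_insert_iff, Set.mem_singleton_iff]
  constructor
  · rintro (rfl | rfl | rfl)
    · exact ⟨1, Or.inl rfl, (mul_one _).symm⟩
    · exact ⟨_, Or.inr (Or.inl rfl), rfl⟩
    · exact ⟨_, Or.inr (Or.inr rfl), rfl⟩
  · rintro ⟨_, rfl | rfl | rfl, rfl⟩ <;> simp

end Eigenfunctions

end AffineBuilding

end

/-! ### The proposition -/

open AffineBuilding in
theorem proposition5p1 (K : Type*) [Field K] [Fintype K] (q : ℕ) (hq : Fintype.card K = q) :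
    -- a simultaneous eigenfunction `f_s`, `s ∈ S`, is in `L²_w` exactly if it is trivial
    (∀ s ∈ paramSet, ∀ f : QVertex K → ℂ,
      IsEigenfunction (q * (s 0 + s 1 + s 2)) (q * ((s 0)⁻¹ + (s 1)⁻¹ + (s 2)⁻¹)) f →
      (MemL2 f ↔ ∃ ω c : ℂ, ω ^ 3 = 1 ∧ c ≠ 0 ∧
        ∀ m n : ℕ, n ≤ m → f (vtx K m n) = c * ω ^ (m + n))) ∧
    -- every trivial function is a simultaneous eigenfunction `f_s` and is in `L²_w`
    (∀ ω : ℂ, ω ^ 3 = 1 → ∃ s ∈ paramSet, ∃ f : QVertex K → ℂ,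
      (∀ m n : ℕ, n ≤ m → f (vtx K m n) = ω ^ (m + n)) ∧ MemL2 f ∧
      IsEigenfunction (q * (s 0 + s 1 + s 2)) (q * ((s 0)⁻¹ + (s 1)⁻¹ + (s 2)⁻¹)) f) ∧
    -- the simultaneous discrete spectrum of `A_w⁺` and `A_w⁻`
    {p : ℂ × ℂ | ∃ f : QVertex K → ℂ, MemL2 f ∧ IsEigenfunction p.1 p.2 f} =
      {p : ℂ × ℂ | ∃ ω : ℂ, ω ^ 3 = 1 ∧
        p = (((q : ℂ) ^ 2 + q + 1) * ω, ((q : ℂ) ^ 2 + q + 1) * ω⁻¹)} ∧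
    -- the discrete spectrum of each of `A_w⁺` and `A_w⁻` is `Σ₀`
    (∀ i : ZMod 3, i = 1 ∨ i = -1 →
      {l : ℂ | ∃ f : QVertex K → ℂ, MemL2 f ∧ f ≠ 0 ∧ ∀ u, adjOp i f u = l * f u} =
        {(q : ℂ) ^ 2 + q + 1,
          ((q : ℂ) ^ 2 + q + 1) * Complex.exp (2 * Real.pi * Complex.I / 3),
          ((q : ℂ) ^ 2 + q + 1) * Complex.exp (4 * Real.pi * Complex.I / 3)}) := by
  subst hq
  refine ⟨fun s hs f hf => ⟨fun hL => ?_, ?_⟩, fun ω hω => ?_, ?_, fun i hi => ?_⟩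
  · obtain ⟨ω, hω, hlp, hlm⟩ := eigenvalue_of_memL2 hf hL (by
      rw [map_mul, hs.2, Complex.conj_natCast])
    rw [hlp, hlm] at hf
    exact ⟨ω, f (vtx K 0 0), hω, apply_vtx_zero_ne_zero hf,
      fun m n h => eq_trivialFunction_of_isEigenfunction hω hf h⟩
  · rintro ⟨ω, c, hω, -, hf⟩
    exact memL2_of_vtx_eq hω hf
  · have hq : (Fintype.card K : ℂ) ≠ 0 := by exact_mod_cast Fintype.card_ne_zero
    have hω0 : ω ≠ 0 := by
      rintro rfl
      norm_num at hω
    have hωi := inv_of_cube hω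
    have hωc := conj_of_cube hω
    -- The parameters `q^{-1}, 1, q` of the constant function, twisted by `ω⁻¹`; `q` times their sum
    -- is `(q²+q+1)ω⁻¹`.
    refine ⟨![(Fintype.card K : ℂ)⁻¹ * ω⁻¹, ω⁻¹, Fintype.card K * ω⁻¹], ⟨?_, ?_⟩,
      trivialFunction K ω, fun m n h => trivialFunction_vtx ω h, memL2_trivialFunction hω, ?_⟩
    · change (Fintype.card K : ℂ)⁻¹ * ω⁻¹ * ω⁻¹ * (Fintype.card K * ω⁻¹) = 1
      field_simp
      exact hω.symm
    · change (starRingEnd ℂ) ((Fintype.card K : ℂ)⁻¹ * ω⁻¹ + ω⁻¹ + Fintype.card K * ω⁻¹) =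
        ((Fintype.card K : ℂ)⁻¹ * ω⁻¹)⁻¹ + (ω⁻¹)⁻¹ + (Fintype.card K * ω⁻¹)⁻¹
      simp only [map_add, map_mul, map_inv₀, Complex.conj_natCast, hωc, mul_inv, inv_inv]
      ring
    · convert isEigenfunction_trivialFunction hω using 1
      · change (Fintype.card K : ℂ) *
          ((Fintype.card K : ℂ)⁻¹ * ω⁻¹ + ω⁻¹ + Fintype.card K * ω⁻¹) = _
        field_simp
        ring
      · change (Fintype.card K : ℂ) * (((Fintype.card K : ℂ)⁻¹ * ω⁻¹)⁻¹ + (ω⁻¹)⁻¹ +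
          (Fintype.card K * ω⁻¹)⁻¹) = _
        field_simp
  · ext p
    constructor
    · rintro ⟨f, hL, hf⟩
      have h0 := apply_vtx_zero_ne_zero hf
      -- No `s ∈ S` is given here, so the conjugacy is derived from normality and `f(v_{0,0}) ≠ 0`.
      have hconj : (starRingEnd ℂ) p.1 = p.2 := by
        apply mul_right_cancel₀ h0
        rw [← hf.2.2, adjOp_neg_one_eq_of_memL2 hL hf.2.1]
      obtain ⟨ω, hω, hlp, hlm⟩ := eigenvalue_of_memL2 hf hL hconj
      exact ⟨ω⁻¹, by rw [inv_pow, hω, inv_one], by rw [inv_inv]; exact Prod.ext hlp hlm⟩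
    · rintro ⟨ω, hω, rfl⟩
      -- The trivial function of `ω` has `A_w⁺`-eigenvalue with `ω⁻¹`, hence the inversion.
      have hω' : ω⁻¹ ^ 3 = 1 := by rw [inv_pow, hω, inv_one]
      have h := isEigenfunction_trivialFunction (K := K) hω'
      rw [inv_inv] at h
      exact ⟨trivialFunction K ω⁻¹, memL2_trivialFunction hω', h⟩
  · ext l
    rw [mem_cube_roots_iff]
    constructor
    · rintro ⟨f, hL, hf, hl⟩
      rcases hi with rfl | rfl
      · obtain ⟨ω, hω, hlp, -⟩ := eigenvalue_of_memL2
          ⟨hf, hl, adjOp_neg_one_eq_of_memL2 hL hl⟩ hL rfl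
        exact ⟨ω⁻¹, by rw [inv_pow, hω, inv_one], hlp⟩
      · obtain ⟨ω, hω, -, hlm⟩ := eigenvalue_of_memL2
          ⟨hf, adjOp_one_eq_of_memL2 hL hl, hl⟩ hL (Complex.conj_conj l)
        exact ⟨ω, hω, hlm⟩
    · rintro ⟨ω, hω, rfl⟩
      have hω' : ω⁻¹ ^ 3 = 1 := by rw [inv_pow, hω, inv_one]
      rcases hi with rfl | rfl
      · have h := isEigenfunction_trivialFunction (K := K) hω'
        rw [inv_inv] at h
        exact ⟨_, memL2_trivialFunction hω', h.1, h.2.1⟩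
      · have h := isEigenfunction_trivialFunction (K := K) hω
        exact ⟨_, memL2_trivialFunction hω, h.1, h.2.2⟩
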